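/- **Setting.** Let $e$ be a unit vector and $o$ a point of $\mathbf R^{n+1}$, $J\subset\mathbf R$ an open interval, $r:J\to(0,\infty)$ a smooth function and $x_0(t)=o+te$. Let $M=\bigcup_{t\in J}S^{n-1}(t)$ be the rotational hypersurface (with the metric $g$ induced from $\mathbf R^{n+1}$) whose parallels are the spheres $$S^{n-1}(t)=\{X\in\mathbf R^{n+1} : |X-x_0(t)|^2=r(t)^2,\ \langle e,X-x_0(t)\rangle=0\},\qquad t\in J .$$ Let $\nabla$ be the Levi-Civita connection of $(M,g)$, $R(X,Y)=[\nabla_X,\nabla_Y]-\nabla_{[X,Y]}$ and $R(X,Y,Z,U)=g(R(X,Y)Z,U)$. For a 2-plane $E\subset T_pM$ with orthonormal basis $\{X,Y\}$ the sectional 1-form is $\varphi_E(Z)=(\nabla_ZR)(X,Y,Y,X)$, $Z\in E$. A Riemannian manifold is said to be directed by a smooth unit 1-form $\eta$ if, for every $p$ and every 2-plane $E\subset T_pM$, the form $\varphi_E$ does not depend on the orthonormal basis and satisfies $\varphi_E=k(E,p)\,\eta|_E$ for some number $k(E,p)$ when $\eta|_E\neq0$, and $\varphi_E=0$ when $\eta|_E=0$.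 It is directed if it is directed by some such $\eta$. **Proposition 3.1.** Every rotational hypersurface $(M,g)$ in $\mathbf R^{n+1}$ is a directed Riemannian manifold. More precisely, there is a smooth unit vector field $\xi$ on $M$ orthogonal to the parallels, and for every such $\xi$ the manifold is directed by the dual 1-form $\eta=g(\xi,\cdot)$. Moreover, with the functions on $M$ $$a=\frac1{r^2(1+r'^2)},\qquad b=-\frac{1+r'^2+rr''}{r^2(1+r'^2)^2}$$ (evaluated at the parameter $t$ of the parallel through the point), there is a function $\lambda$ on $M$ such that $\nabla_x\xi=\lambda x$ for all $x\perp\xi$ and $2\lambda b=\xi(a)$, and for every 2-plane $E\subset T_pM$ $$\varphi_E=\bigl[4\lambda b+(\xi(b)-2b\lambda)\cos^2\gamma\bigr]\,\eta|_E ,$$ where $\gamma$ is the angle between $\xi$ and $E$. -/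

import Mathlib

open scoped Manifold ContDiff

noncomputable section

/-! ### Riemannian metrics on open sets of `ℝⁿ`

A metric is given by its values `G x u v = g_x(u, v)`; vectors `u v w … : ℝⁿ` are also read as
constant (coordinate) vector fields. -/

namespace CoordMetric

variable {n : ℕ}

/-- Gram matrix `g_{ij}(x)` in the standard basis. -/
def gram (G : EuclideanSpace ℝ (Fin n) → EuclideanSpace ℝ (Fin n) → EuclideanSpace ℝ (Fin n) → ℝ)
    (x : EuclideanSpace ℝ (Fin n)) : Matrix (Fin n) (Fin n) ℝ :=
  Matrix.of fun i j => G x (EuclideanSpace.single i 1) (EuclideanSpace.single j 1)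

/-- Christoffel symbols of the first kind,
`Γ(u, v; w) = ½ (u g(v, w) + v g(u, w) - w g(u, v))` for constant vector fields `u, v, w`. -/
def christoffelFirst
    (G : EuclideanSpace ℝ (Fin n) → EuclideanSpace ℝ (Fin n) → EuclideanSpace ℝ (Fin n) → ℝ)
    (x u v w : EuclideanSpace ℝ (Fin n)) : ℝ :=
  (1 / 2) * (fderiv ℝ (fun y => G y v w) x u + fderiv ℝ (fun y => G y u w) x v
    - fderiv ℝ (fun y => G y u v) x w)

/-- Christoffel symbols of the second kind as a vector, `Γ(u, v) = ∑ₖₗ gᵏˡ Γ(u, v; eₗ) eₖ`. -/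
def christoffel
    (G : EuclideanSpace ℝ (Fin n) → EuclideanSpace ℝ (Fin n) → EuclideanSpace ℝ (Fin n) → ℝ)
    (x u v : EuclideanSpace ℝ (Fin n)) : EuclideanSpace ℝ (Fin n) :=
  ∑ k, (∑ l, (gram G x)⁻¹ k l * christoffelFirst G x u v (EuclideanSpace.single l 1)) •
    EuclideanSpace.single k (1 : ℝ)

/-- Levi-Civita derivative `∇_X Y` of a vector field `Y` along a vector field `X`. -/
def covDeriv
    (G : EuclideanSpace ℝ (Fin n) → EuclideanSpace ℝ (Fin n) → EuclideanSpace ℝ (Fin n) → ℝ)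
    (X Y : EuclideanSpace ℝ (Fin n) → EuclideanSpace ℝ (Fin n)) (x : EuclideanSpace ℝ (Fin n)) :
    EuclideanSpace ℝ (Fin n) :=
  fderiv ℝ Y x (X x) + christoffel G x (X x) (Y x)

/-- Curvature operator `R(u, v)w = ∇_u ∇_v w - ∇_v ∇_u w`; the term `∇_{[u, v]} w` vanishes, as
`u, v` are constant vector fields. -/
def curvatureOp
    (G : EuclideanSpace ℝ (Fin n) → EuclideanSpace ℝ (Fin n) → EuclideanSpace ℝ (Fin n) → ℝ)
    (x u v w : EuclideanSpace ℝ (Fin n)) : EuclideanSpace ℝ (Fin n) :=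
  covDeriv G (fun _ => u) (covDeriv G (fun _ => v) (fun _ => w)) x
    - covDeriv G (fun _ => v) (covDeriv G (fun _ => u) (fun _ => w)) x

/-- Curvature tensor `R(u, v, w, z) = g(R(u, v)w, z)`. -/
def curvature
    (G : EuclideanSpace ℝ (Fin n) → EuclideanSpace ℝ (Fin n) → EuclideanSpace ℝ (Fin n) → ℝ)
    (x u v w z : EuclideanSpace ℝ (Fin n)) : ℝ :=
  G x (curvatureOp G x u v w) z

/-- Covariant derivative `(∇_s R)(u, v, w, z)` of the curvature tensor; here `∇_s u = Γ(s, u)` for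
constant vector fields. -/
def nablaCurvature
    (G : EuclideanSpace ℝ (Fin n) → EuclideanSpace ℝ (Fin n) → EuclideanSpace ℝ (Fin n) → ℝ)
    (x s u v w z : EuclideanSpace ℝ (Fin n)) : ℝ :=
  fderiv ℝ (fun y => curvature G y u v w z) x s
    - curvature G x (christoffel G x s u) v w z - curvature G x u (christoffel G x s v) w z
    - curvature G x u v (christoffel G x s w) z - curvature G x u v w (christoffel G x s z)

end CoordMetric

/-! ### Smooth Riemannian manifolds -/

/-- Smooth Riemannian metrics on an `n`-dimensional manifold `M`. -/
abbrev RiemMetric (n : ℕ) (M : Type*) [TopologicalSpace M]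
    [ChartedSpace (EuclideanSpace ℝ (Fin n)) M] [IsManifold (𝓡 n) ∞ M] :=
  Bundle.ContMDiffRiemannianMetric (𝓡 n) ∞ (EuclideanSpace ℝ (Fin n))
    (fun p : M => TangentSpace (𝓡 n) p)

namespace RiemMetric

variable {n : ℕ} {M : Type*} [TopologicalSpace M] [ChartedSpace (EuclideanSpace ℝ (Fin n)) M]
  [IsManifold (𝓡 n) ∞ M]

/-- Coordinates, in the chart at `p`, of a tangent vector at a point `q` of its domain. -/
def toChart (p : M) {q : M} (v : TangentSpace (𝓡 n) q) : EuclideanSpace ℝ (Fin n) :=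
  mfderiv (𝓡 n) 𝓘(ℝ, EuclideanSpace ℝ (Fin n)) (extChartAt (𝓡 n) p) q v

/-- Tangent vector at the point with coordinates `x` in the chart at `p`, with coordinates `u`. -/
def ofChart (p : M) (x u : EuclideanSpace ℝ (Fin n)) :
    TangentSpace (𝓡 n) ((extChartAt (𝓡 n) p).symm x) :=
  mfderiv 𝓘(ℝ, EuclideanSpace ℝ (Fin n)) (𝓡 n) (extChartAt (𝓡 n) p).symm x u

/-- The metric in the chart at `p`. -/
def chartMetric (g : RiemMetric n M) (p : M) (x u v : EuclideanSpace ℝ (Fin n)) : ℝ :=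
  g.inner ((extChartAt (𝓡 n) p).symm x) (ofChart p x u) (ofChart p x v)

/-- `∇_v ξ` at `p`, in the coordinates of the chart at `p`, for the Levi-Civita connection `∇`,
`v ∈ T_pM` and a vector field `ξ`. -/
def leviCivitaCoord (g : RiemMetric n M) (ξ : ∀ p : M, TangentSpace (𝓡 n) p) (p : M)
    (v : TangentSpace (𝓡 n) p) : EuclideanSpace ℝ (Fin n) :=
  CoordMetric.covDeriv (chartMetric g p) (fun _ => toChart p v)
    (fun x => toChart p (ξ ((extChartAt (𝓡 n) p).symm x))) (extChartAt (𝓡 n) p p)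

/-- The tensor `(∇_W R)(X, Y, Z, U)` at `p`, evaluated in the chart at `p`. -/
def nablaR (g : RiemMetric n M) (p : M) (W X Y Z U : TangentSpace (𝓡 n) p) : ℝ :=
  CoordMetric.nablaCurvature (chartMetric g p) (extChartAt (𝓡 n) p p)
    (toChart p W) (toChart p X) (toChart p Y) (toChart p Z) (toChart p U)

/-- `(X, Y)` is an orthonormal basis of the 2-plane `E` in `T_pM`. -/
structure IsOrthonormalBasis (g : RiemMetric n M) (p : M)
    (E : Submodule ℝ (TangentSpace (𝓡 n) p)) (X Y : TangentSpace (𝓡 n) p) : Prop where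
  norm_fst : g.inner p X X = 1
  norm_snd : g.inner p Y Y = 1
  orthogonal : g.inner p X Y = 0
  span_eq : Submodule.span ℝ {X, Y} = E

/-- The sectional 1-form `φ_E(Z) = (∇_Z R)(X, Y, Y, X)`, `Z ∈ E`, computed with an orthonormal
basis `(X, Y)` of `E`. -/
def sectionalForm (g : RiemMetric n M) (p : M) (X Y Z : TangentSpace (𝓡 n) p) : ℝ :=
  nablaR g p Z X Y Y X

/-- `(M, g)` is directed by the smooth unit 1-form `η`, with distribution `Δ = ker η`. -/
structure IsDirectedBy (g : RiemMetric n M) (η : ∀ p : M, TangentSpace (𝓡 n) p →L[ℝ] ℝ) :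
    Prop where
  smooth : ContMDiff (𝓡 n) ((𝓡 n).prod 𝓘(ℝ, EuclideanSpace ℝ (Fin n) →L[ℝ] ℝ)) ∞
    (fun p : M => Bundle.TotalSpace.mk' (EuclideanSpace ℝ (Fin n) →L[ℝ] ℝ)
      (E := fun q : M => TangentSpace (𝓡 n) q →L[ℝ] Bundle.Trivial M ℝ q) p (η p))
  unit : ∀ p : M, IsGreatest (η p '' {v | g.inner p v v = 1}) 1
  collinear : ∀ (p : M) (E : Submodule ℝ (TangentSpace (𝓡 n) p)), Module.finrank ℝ E = 2 →
    (¬ ∀ v ∈ E, η p v = 0) →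
    ∃ k : ℝ, ∀ X Y, IsOrthonormalBasis g p E X Y → ∀ Z ∈ E, sectionalForm g p X Y Z = k * η p Z
  vanishing : ∀ (p : M) (E : Submodule ℝ (TangentSpace (𝓡 n) p)), Module.finrank ℝ E = 2 →
    (∀ v ∈ E, η p v = 0) →
    ∀ X Y, IsOrthonormalBasis g p E X Y → ∀ Z ∈ E, sectionalForm g p X Y Z = 0

/-- `(M, g)` is a directed Riemannian manifold. -/
def IsDirected (g : RiemMetric n M) : Prop :=
  ∃ η : ∀ p : M, TangentSpace (𝓡 n) p →L[ℝ] ℝ, IsDirectedBy g η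

/-- Angle between the nonzero tangent vectors `v` and `w`. -/
def angle (g : RiemMetric n M) (p : M) (v w : TangentSpace (𝓡 n) p) : ℝ :=
  Real.arccos (g.inner p v w / (√(g.inner p v v) * √(g.inner p w w)))

/-- Angle between a nonzero vector `v` and a plane `E`: the least angle between `v` and a nonzero
vector of `E`. -/
def anglePlane (g : RiemMetric n M) (p : M) (v : TangentSpace (𝓡 n) p)
    (E : Submodule ℝ (TangentSpace (𝓡 n) p)) : ℝ :=
  sInf {θ | ∃ Z ∈ E, Z ≠ 0 ∧ θ = angle g p v Z}

end RiemMetric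

/-! ### Rotational hypersurfaces of `ℝⁿ⁺¹` -/

/-- Data of a rotational hypersurface: the axis through `origin` oriented by the unit vector `e`,
an open interval `J` of heights along the axis, and the smooth positive radius function `r`. -/
structure RotationalHypersurface (n : ℕ) where
  origin : EuclideanSpace ℝ (Fin (n + 1))
  e : EuclideanSpace ℝ (Fin (n + 1))
  norm_e : ‖e‖ = 1
  J : Set ℝ
  isOpen_J : IsOpen J
  ordConnected_J : J.OrdConnected
  r : ℝ → ℝ
  contDiffOn_r : ContDiffOn ℝ ∞ r J
  r_pos : ∀ t ∈ J, 0 < r t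

namespace RotationalHypersurface

variable {n : ℕ} (S : RotationalHypersurface n)

/-- Centre `x₀(t)` of the parallel at height `t`. -/
def center (t : ℝ) : EuclideanSpace ℝ (Fin (n + 1)) := S.origin + t • S.e

/-- The parallel at height `t`: the `(n-1)`-sphere of centre `x₀(t)` and radius `r(t)` in the
hyperplane through `x₀(t)` orthogonal to `e`. -/
def parallel (t : ℝ) : Set (EuclideanSpace ℝ (Fin (n + 1))) :=
  {X | ‖X - S.center t‖ ^ 2 = S.r t ^ 2 ∧ inner ℝ S.e (X - S.center t) = 0}

/-- The set of points of the hypersurface. -/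
def carrier : Set (EuclideanSpace ℝ (Fin (n + 1))) := ⋃ t ∈ S.J, S.parallel t

/-- The height `t` of a point along the axis. -/
def height (X : EuclideanSpace ℝ (Fin (n + 1))) : ℝ := inner ℝ S.e (X - S.origin)

/-- `a = 1 / (r² (1 + r'²))`. -/
def a (t : ℝ) : ℝ := 1 / (S.r t ^ 2 * (1 + deriv S.r t ^ 2))

/-- `b = - (1 + r'² + r r'') / (r² (1 + r'²)²)`. -/
def b (t : ℝ) : ℝ :=
  -((1 + deriv S.r t ^ 2 + S.r t * deriv (deriv S.r) t) /
    (S.r t ^ 2 * (1 + deriv S.r t ^ 2) ^ 2))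

variable {M : Type*} [TopologicalSpace M] [ChartedSpace (EuclideanSpace ℝ (Fin n)) M]
  [IsManifold (𝓡 n) ∞ M]

/-- Image in `ℝⁿ⁺¹` of a tangent vector of `M` under the differential of `ι : M → ℝⁿ⁺¹`. -/
def ambientVector (ι : M → EuclideanSpace ℝ (Fin (n + 1))) (p : M)
    (v : TangentSpace (𝓡 n) p) : EuclideanSpace ℝ (Fin (n + 1)) :=
  mfderiv (𝓡 n) 𝓘(ℝ, EuclideanSpace ℝ (Fin (n + 1))) ι p v

/-- `(M, g)` is the rotational hypersurface `S`: the inclusion `ι` is a smooth embedding of `M` onto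
the set of points of `S`, and `g` is the metric induced from `ℝⁿ⁺¹`. -/
structure IsRealizedBy (g : RiemMetric n M) (ι : M → EuclideanSpace ℝ (Fin (n + 1))) : Prop where
  embedding : Manifold.IsSmoothEmbedding (𝓡 n) 𝓘(ℝ, EuclideanSpace ℝ (Fin (n + 1))) ∞ ι
  range_eq : Set.range ι = S.carrier
  metric_eq : ∀ (p : M) (v w : TangentSpace (𝓡 n) p),
    g.inner p v w = inner ℝ (ambientVector ι p v) (ambientVector ι p w)

/-- `ξ` is a smooth unit vector field on `M` orthogonal to the parallels. The tangent space at `p`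
of the parallel through `p` consists of the `v ∈ T_pM` whose image in `ℝⁿ⁺¹` is orthogonal
to `e`. -/
structure IsMeridianField (g : RiemMetric n M) (ι : M → EuclideanSpace ℝ (Fin (n + 1)))
    (ξ : ∀ p : M, TangentSpace (𝓡 n) p) : Prop where
  smooth : ContMDiff (𝓡 n) (𝓡 n).tangent ∞ (fun p : M => (⟨p, ξ p⟩ : TangentBundle (𝓡 n) M))
  unit : ∀ p : M, g.inner p (ξ p) (ξ p) = 1
  orthogonal : ∀ (p : M) (v : TangentSpace (𝓡 n) p),
    inner ℝ S.e (ambientVector ι p v) = 0 → g.inner p (ξ p) v = 0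

end RotationalHypersurface

/-- Derivative at `p` of a function `f` on `M` in the direction of the vector field `ξ`. -/
def dirDeriv {n : ℕ} {M : Type*} [TopologicalSpace M] [ChartedSpace (EuclideanSpace ℝ (Fin n)) M]
    (ξ : ∀ p : M, TangentSpace (𝓡 n) p) (f : M → ℝ) (p : M) : ℝ :=
  mfderiv (𝓡 n) 𝓘(ℝ, ℝ) f p (ξ p)

end

/-! Write `s = √(1 + r'²)`, let `t` be the height along the axis, and let `η` be dual to the unit
tangent `T` of the meridians. Everything rests on the second fundamental form `h`. With the outward
normal it is `A g + B η ⊗ η`, where `A = -1/(r s)` and `B = (s² + r r'')/(r s³)`, since all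
directions tangent to a parallel are umbilic (`secondForm_eq`). In the Gauss equation the `B²` terms
cancel, so the curvature is built from `g` and `η` with coefficients `A² = a` and `A B = b`
(`IsParametrization.curvature_eq`).

To differentiate it covariantly, three facts suffice: `∇η = λ (g - η ⊗ η)` (`fderiv_covector`), `da
= 2 λ b η` (`hasDerivAt_a`) and `db = (b'/s) η`. On an orthonormal pair `(u, v)` the derivative of
`a + b (η(u)² + η(v)²)` along `z` is then `2 λ b η(z)`, plus `(b'/s) η(z) (η(u)² + η(v)²)`, plus `2
λ b (η(u) g(z,u) + η(v) g(z,v) - η(z) (η(u)² + η(v)²))` (`nablaCurvature_eq`). For `z` in the plane,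
`η(u) g(z,u) + η(v) g(z,v) = η(z)`, and `η(u)² + η(v)² = cos² γ` (`cos_anglePlane_sq`); this is the
stated formula for `T`.

Any other unit field orthogonal to the parallels is `σ T` with a locally constant sign `σ`
(`exists_sign`). Then `λ`, `ξ(b)` and `η` all change by the factor `σ`, and `σ² = 1` leaves the
formula intact.

The computations are done for a parametrization `f` of the hypersurface by an open set of `ℝⁿ`, then
applied to the inclusion read in each chart of `M`. -/

/-! ### Smooth left inverses of injective linear maps. -/

section LeftInverse

variable {n : ℕ} {W : Type*} [NormedAddCommGroup W] [InnerProductSpace ℝ W] [CompleteSpace W]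

/-- The left inverse `(A* A)⁻¹ A*` of an injective linear map `A`. -/
noncomputable def ContinuousLinearMap.leftPseudoInverse (A : EuclideanSpace ℝ (Fin n) →L[ℝ] W) :
    W →L[ℝ] EuclideanSpace ℝ (Fin n) :=
  (ContinuousLinearMap.inverse (A.adjoint.comp A)).comp A.adjoint

/-- If `A* A v = 0` then `|A v|² = ⟨A* A v, v⟩ = 0`; in finite dimension injectivity is enough. -/
theorem ContinuousLinearMap.isInvertible_adjoint_comp_self
    {A : EuclideanSpace ℝ (Fin n) →L[ℝ] W} (hA : Function.Injective A) :
    (A.adjoint.comp A).IsInvertible := by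
  have hinj : Function.Injective (A.adjoint.comp A) := by
    refine (injective_iff_map_eq_zero _).2 fun v hv => ?_
    have h : inner ℝ (A v) (A v) = 0 := by
      rw [← ContinuousLinearMap.adjoint_inner_left]
      rw [ContinuousLinearMap.comp_apply] at hv
      rw [hv, inner_zero_left]
    exact (injective_iff_map_eq_zero _).1 hA v (inner_self_eq_zero.1 h)
  exact ⟨(LinearEquiv.ofInjectiveEndo (A.adjoint.comp A).toLinearMap
    hinj).toContinuousLinearEquiv, by ext v; rfl⟩

theorem ContinuousLinearMap.leftPseudoInverse_apply_self
    {A : EuclideanSpace ℝ (Fin n) →L[ℝ] W} (hA : Function.Injective A)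
    (v : EuclideanSpace ℝ (Fin n)) : A.leftPseudoInverse (A v) = v := by
  have h := (isInvertible_adjoint_comp_self hA).inverse_apply_eq (x := v) (y := A.adjoint (A v))
  exact h.2 rfl

/-- Adjunction, composition and inversion of invertible operators are smooth operations. This is why
an explicit left inverse is used rather than a chosen one. -/
theorem ContDiffOn.leftPseudoInverse {E : Type*} [NormedAddCommGroup E] [NormedSpace ℝ E]
    {A : E → EuclideanSpace ℝ (Fin n) →L[ℝ] W} {U : Set E} {m : ℕ∞ω} (hA : ContDiffOn ℝ m A U)
    (hinj : ∀ x ∈ U, Function.Injective (A x)) :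
    ContDiffOn ℝ m (fun x => (A x).leftPseudoInverse) U := by
  have hadj : ContDiffOn ℝ m (fun x => (A x).adjoint) U :=
    (ContinuousLinearMap.adjoint (𝕜 := ℝ) (E := EuclideanSpace ℝ (Fin n))
      (F := W)).toLinearIsometry.toContinuousLinearMap.contDiff.comp_contDiffOn hA
  have hcomp : ContDiffOn ℝ m (fun x => (A x).adjoint.comp (A x)) U := hadj.clm_comp hA
  refine ContDiffOn.clm_comp (fun x hx => ?_) hadj
  exact ((ContinuousLinearMap.isInvertible_adjoint_comp_self
    (hinj x hx)).contDiffAt_map_inverse).comp_contDiffWithinAt x (hcomp x hx)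

end LeftInverse

/-! ### Immersed hypersurfaces in coordinates: the formulas of Gauss and Weingarten. -/

namespace CoordMetric

variable {n : ℕ} {G : EuclideanSpace ℝ (Fin n) → EuclideanSpace ℝ (Fin n) →
  EuclideanSpace ℝ (Fin n) → ℝ} {U : Set (EuclideanSpace ℝ (Fin n))}
  {f N : EuclideanSpace ℝ (Fin n) → EuclideanSpace ℝ (Fin (n + 1))}
  {x : EuclideanSpace ℝ (Fin n)}

/-- `f` is an immersion of the open set `U` as a hypersurface with unit normal `N`, and `G` is the
induced metric on `U`. -/
structure IsHypersurfaceOn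
    (G : EuclideanSpace ℝ (Fin n) → EuclideanSpace ℝ (Fin n) → EuclideanSpace ℝ (Fin n) → ℝ)
    (U : Set (EuclideanSpace ℝ (Fin n)))
    (f N : EuclideanSpace ℝ (Fin n) → EuclideanSpace ℝ (Fin (n + 1))) : Prop where
  isOpen : IsOpen U
  contDiffOn : ContDiffOn ℝ ∞ f U
  contDiffOn_normal : ContDiffOn ℝ ∞ N U
  metric_eq : ∀ x ∈ U, ∀ u v, G x u v = inner ℝ (fderiv ℝ f x u) (fderiv ℝ f x v)
  injective : ∀ x ∈ U, Function.Injective (fderiv ℝ f x)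
  inner_normal_self : ∀ x ∈ U, inner ℝ (N x) (N x) = (1 : ℝ)
  inner_normal : ∀ x ∈ U, ∀ u, inner ℝ (fderiv ℝ f x u) (N x) = (0 : ℝ)

/-- Second derivative `∂_u ∂_v f`. -/
noncomputable def hess (f : EuclideanSpace ℝ (Fin n) → EuclideanSpace ℝ (Fin (n + 1)))
    (x u v : EuclideanSpace ℝ (Fin n)) : EuclideanSpace ℝ (Fin (n + 1)) :=
  fderiv ℝ (fun y => fderiv ℝ f y v) x u

/-- Second fundamental form `⟨∂_u ∂_v f, N⟩`. -/
noncomputable def secondForm (f N : EuclideanSpace ℝ (Fin n) → EuclideanSpace ℝ (Fin (n + 1)))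
    (x u v : EuclideanSpace ℝ (Fin n)) : ℝ :=
  inner ℝ (hess f x u v) (N x)

namespace IsHypersurfaceOn

variable (H : IsHypersurfaceOn G U f N)

theorem mem_nhds (H : IsHypersurfaceOn G U f N) (hx : x ∈ U) : U ∈ nhds x := H.isOpen.mem_nhds hx

theorem contDiffOn_fderiv (H : IsHypersurfaceOn G U f N) : ContDiffOn ℝ ∞ (fderiv ℝ f) U :=
  H.contDiffOn.fderiv_of_isOpen H.isOpen (by norm_num)

theorem contDiffOn_fderiv_apply (H : IsHypersurfaceOn G U f N) (v : EuclideanSpace ℝ (Fin n)) :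
    ContDiffOn ℝ ∞ (fun y => fderiv ℝ f y v) U :=
  H.contDiffOn_fderiv.clm_apply contDiffOn_const

theorem differentiableAt_fderiv_apply (H : IsHypersurfaceOn G U f N) (hx : x ∈ U)
    (v : EuclideanSpace ℝ (Fin n)) : DifferentiableAt ℝ (fun y => fderiv ℝ f y v) x :=
  ((H.contDiffOn_fderiv_apply v).contDiffAt (H.mem_nhds hx)).differentiableAt (by simp)

theorem contDiffOn_hess (H : IsHypersurfaceOn G U f N) (u v : EuclideanSpace ℝ (Fin n)) :
    ContDiffOn ℝ ∞ (fun y => hess f y u v) U :=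
  ((H.contDiffOn_fderiv_apply v).fderiv_of_isOpen H.isOpen (m := ∞) (by norm_num)).clm_apply
    contDiffOn_const

theorem differentiableAt_hess (H : IsHypersurfaceOn G U f N) (hx : x ∈ U)
    (u v : EuclideanSpace ℝ (Fin n)) : DifferentiableAt ℝ (fun y => hess f y u v) x :=
  ((H.contDiffOn_hess u v).contDiffAt (H.mem_nhds hx)).differentiableAt (by simp)

theorem differentiableAt_normal (H : IsHypersurfaceOn G U f N) (hx : x ∈ U) :
    DifferentiableAt ℝ N x :=
  (H.contDiffOn_normal.contDiffAt (H.mem_nhds hx)).differentiableAt (by simp)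

theorem hess_symm (H : IsHypersurfaceOn G U f N) (hx : x ∈ U) (u v : EuclideanSpace ℝ (Fin n)) :
    hess f x u v = hess f x v u := by
  have hd : DifferentiableAt ℝ (fderiv ℝ f) x :=
    (H.contDiffOn_fderiv.contDiffAt (H.mem_nhds hx)).differentiableAt (by simp)
  have h : ∀ a b, hess f x a b = fderiv ℝ (fderiv ℝ f) x a b := fun a b => by
    rw [hess, fderiv_clm_apply hd (differentiableAt_const b)]
    simp
  rw [h, h]
  exact ((H.contDiffOn.contDiffAt (H.mem_nhds hx)).isSymmSndFDerivAt
    (by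
      rw [minSmoothness_of_isRCLikeNormedField]; exact ENat.LEInfty.out)).eq u v

/-- This is what cancels the third derivatives of `f` in the Gauss equation. -/
theorem fderiv_hess_symm (H : IsHypersurfaceOn G U f N) (hx : x ∈ U)
    (u v w : EuclideanSpace ℝ (Fin n)) :
    fderiv ℝ (fun y => hess f y v w) x u = fderiv ℝ (fun y => hess f y u w) x v := by
  have hd : DifferentiableAt ℝ (fderiv ℝ (fun y => fderiv ℝ f y w)) x :=
    (((H.contDiffOn_fderiv_apply w).fderiv_of_isOpen H.isOpen (m := ∞)
      (by norm_num)).contDiffAt (H.mem_nhds hx)).differentiableAt (by simp)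
  have h : ∀ a b, fderiv ℝ (fun y => hess f y b w) x a
      = fderiv ℝ (fderiv ℝ (fun y => fderiv ℝ f y w)) x a b := fun a b => by
    simp only [hess]
    rw [fderiv_clm_apply hd (differentiableAt_const b)]
    simp
  rw [h, h]
  exact (((H.contDiffOn_fderiv_apply w).contDiffAt (H.mem_nhds hx)).isSymmSndFDerivAt
    (by
      rw [minSmoothness_of_isRCLikeNormedField]; exact ENat.LEInfty.out)).eq u v

theorem fderiv_metric (H : IsHypersurfaceOn G U f N) (hx : x ∈ U)
    (u v w : EuclideanSpace ℝ (Fin n)) :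
    fderiv ℝ (fun y => G y v w) x u = inner ℝ (hess f x u v) (fderiv ℝ f x w)
      + inner ℝ (fderiv ℝ f x v) (hess f x u w) := by
  have h : (fun y => G y v w) =ᶠ[nhds x] fun y => inner ℝ (fderiv ℝ f y v) (fderiv ℝ f y w) :=
    Filter.eventually_of_mem (H.mem_nhds hx) fun y hy => H.metric_eq y hy v w
  rw [h.fderiv_eq, fderiv_inner_apply _ (H.differentiableAt_fderiv_apply hx v)
    (H.differentiableAt_fderiv_apply hx w), add_comm]
  rfl

/-- Koszul's formula: of the six terms given by `fderiv_metric`, symmetry of the Hessian cancels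
four and makes the other two equal. -/
theorem christoffelFirst_eq (H : IsHypersurfaceOn G U f N) (hx : x ∈ U)
    (u v w : EuclideanSpace ℝ (Fin n)) :
    christoffelFirst G x u v w = inner ℝ (hess f x u v) (fderiv ℝ f x w) := by
  rw [christoffelFirst, H.fderiv_metric hx, H.fderiv_metric hx, H.fderiv_metric hx,
    H.hess_symm hx v u, H.hess_symm hx w u, H.hess_symm hx w v,
    real_inner_comm (hess f x u w), real_inner_comm (hess f x v w)]
  ring

theorem gram_eq (H : IsHypersurfaceOn G U f N) (hx : x ∈ U) :
    gram G x = Matrix.gram ℝ fun i => fderiv ℝ f x (EuclideanSpace.single i 1) := by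
  ext i j
  simp [gram, Matrix.gram_apply, H.metric_eq x hx]

theorem isUnit_gram (H : IsHypersurfaceOn G U f N) (hx : x ∈ U) : IsUnit (gram G x) := by
  rw [H.gram_eq hx]
  refine (Matrix.posDef_gram_of_linearIndependent ?_).isUnit
  have h := ((EuclideanSpace.basisFun (Fin n) ℝ).toBasis.linearIndependent).map'
    (fderiv ℝ f x).toLinearMap (LinearMap.ker_eq_bot.2 (H.injective x hx))
  simpa [Function.comp_def] using h

theorem inner_fderiv_christoffel (H : IsHypersurfaceOn G U f N) (hx : x ∈ U)
    (u v w : EuclideanSpace ℝ (Fin n)) :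
    inner ℝ (fderiv ℝ f x (christoffel G x u v)) (fderiv ℝ f x w)
      = inner ℝ (hess f x u v) (fderiv ℝ f x w) := by
  have key : (innerSL ℝ (fderiv ℝ f x (christoffel G x u v))).comp (fderiv ℝ f x)
      = (innerSL ℝ (hess f x u v)).comp (fderiv ℝ f x) := by
    -- By linearity in `w` it suffices to test on basis vectors, where the inverse Gram matrix in
    -- `christoffel` cancels the Gram matrix.
    refine ContinuousLinearMap.coe_injective
      ((EuclideanSpace.basisFun (Fin n) ℝ).toBasis.ext fun m => ?_)
    have hinv : (gram G x)⁻¹ * gram G x = 1 :=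
      Matrix.nonsing_inv_mul _ ((Matrix.isUnit_iff_isUnit_det _).1 (H.isUnit_gram hx))
    have hsymm : ∀ i j, (gram G x)⁻¹ i j = (gram G x)⁻¹ j i := fun i j => by
      have ht : (gram G x).transpose = gram G x := by
        ext a b
        simp [gram, H.metric_eq x hx, real_inner_comm]
      have := congrFun (congrFun (Matrix.transpose_nonsing_inv (gram G x)) j) i
      rw [ht] at this
      simpa using this
    simp only [OrthonormalBasis.coe_toBasis, EuclideanSpace.basisFun_apply,
      ContinuousLinearMap.coe_coe, ContinuousLinearMap.comp_apply, innerSL_apply_apply]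
    rw [← H.christoffelFirst_eq hx, christoffel, map_sum, sum_inner]
    simp only [map_smul, inner_smul_left, ← H.metric_eq x hx, RCLike.conj_to_real,
      Finset.sum_mul]
    rw [Finset.sum_comm]
    have : ∀ l, ∑ k, (gram G x)⁻¹ k l * christoffelFirst G x u v (EuclideanSpace.single l 1)
        * G x (EuclideanSpace.single k 1) (EuclideanSpace.single m 1)
        = christoffelFirst G x u v (EuclideanSpace.single l 1) * (1 : Matrix (Fin n) (Fin n) ℝ) l m
        := fun l => by
      rw [← hinv, Matrix.mul_apply, Finset.mul_sum]
      refine Finset.sum_congr rfl fun k _ => ?_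
      rw [hsymm k l, gram, Matrix.of_apply]
      ring
    simp [this, Matrix.one_apply]
  exact congrArg (fun L => L w) key

/-- The tangent space has dimension `n` in `ℝⁿ⁺¹`, so its orthogonal complement is the line spanned
by `N x`. -/
theorem eq_smul_normal (H : IsHypersurfaceOn G U f N) (hx : x ∈ U)
    {y : EuclideanSpace ℝ (Fin (n + 1))} (hy : ∀ w, inner ℝ (fderiv ℝ f x w) y = (0 : ℝ)) :
    y = (inner ℝ y (N x) : ℝ) • N x := by
  set K : Submodule ℝ (EuclideanSpace ℝ (Fin (n + 1))) := (fderiv ℝ f x).toLinearMap.range with hK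
  have hKdim : Module.finrank ℝ K = n := by
    rw [hK, LinearMap.finrank_range_of_inj (H.injective x hx)]
    simp
  have hdim : Module.finrank ℝ Kᗮ = 1 := by
    have := K.finrank_add_finrank_orthogonal
    rw [hKdim, finrank_euclideanSpace_fin] at this
    omega
  have hmem : ∀ z, (∀ w, inner ℝ (fderiv ℝ f x w) z = (0 : ℝ)) → z ∈ Kᗮ := by
    rintro z hz _ ⟨w, rfl⟩
    exact hz w
  have hN0 : (⟨N x, hmem _ (H.inner_normal x hx)⟩ : Kᗮ) ≠ 0 := fun h => by
    have h1 := H.inner_normal_self x hx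
    rw [show N x = 0 from congrArg Subtype.val h, inner_zero_left] at h1
    exact zero_ne_one h1
  obtain ⟨c, hc⟩ := (finrank_eq_one_iff_of_nonzero' _ hN0).1 hdim ⟨y, hmem y hy⟩
  have hc' : c • N x = y := congrArg Subtype.val hc
  rw [← hc', inner_smul_left, H.inner_normal_self x hx]
  simp

/-- A vector orthogonal to `N x` lies in the double orthogonal complement of the tangent space,
which is the tangent space itself. -/
theorem exists_fderiv_eq (H : IsHypersurfaceOn G U f N) (hx : x ∈ U)
    {y : EuclideanSpace ℝ (Fin (n + 1))} (hy : inner ℝ y (N x) = (0 : ℝ)) :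
    ∃ w, fderiv ℝ f x w = y := by
  set K : Submodule ℝ (EuclideanSpace ℝ (Fin (n + 1))) := (fderiv ℝ f x).toLinearMap.range with hK
  have hmem : y ∈ Kᗮᗮ := by
    intro z hz
    rw [H.eq_smul_normal hx fun w => hz _ ⟨w, rfl⟩, real_inner_smul_left,
      real_inner_comm y, hy, mul_zero]
  rw [Submodule.orthogonal_orthogonal] at hmem
  exact hmem

/-- Gauss formula. -/
theorem fderiv_christoffel_eq (H : IsHypersurfaceOn G U f N) (hx : x ∈ U)
    -- By `inner_fderiv_christoffel`, the Hessian and the image of the Christoffel vector have the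
    -- same tangential part; they differ by a normal vector.
    (u v : EuclideanSpace ℝ (Fin n)) :
    fderiv ℝ f x (christoffel G x u v) = hess f x u v - secondForm f N x u v • N x := by
  have h := H.eq_smul_normal hx (y := hess f x u v - fderiv ℝ f x (christoffel G x u v))
    fun w => by
      rw [real_inner_comm, inner_sub_left, H.inner_fderiv_christoffel hx, sub_self]
  rw [inner_sub_left, H.inner_normal x hx, sub_zero] at h
  rw [secondForm, ← h]
  abel

theorem contDiffOn_leftPseudoInverse (H : IsHypersurfaceOn G U f N) :
    ContDiffOn ℝ ∞ (fun y => (fderiv ℝ f y).leftPseudoInverse) U :=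
  H.contDiffOn_fderiv.leftPseudoInverse H.injective

theorem contDiffOn_secondForm (H : IsHypersurfaceOn G U f N) (u v : EuclideanSpace ℝ (Fin n)) :
    ContDiffOn ℝ ∞ (fun y => secondForm f N y u v) U :=
  (H.contDiffOn_hess u v).inner ℝ H.contDiffOn_normal

/-- If `f_* V` is smooth, so is `V`. -/
theorem contDiffOn_of_fderiv_apply (H : IsHypersurfaceOn G U f N)
    {V : EuclideanSpace ℝ (Fin n) → EuclideanSpace ℝ (Fin n)}
    {T : EuclideanSpace ℝ (Fin n) → EuclideanSpace ℝ (Fin (n + 1))} (hT : ContDiffOn ℝ ∞ T U)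
    (hV : ∀ y ∈ U, fderiv ℝ f y (V y) = T y) : ContDiffOn ℝ ∞ V U :=
  (H.contDiffOn_leftPseudoInverse.clm_apply hT).congr fun y hy => by
    rw [← hV y hy, ContinuousLinearMap.leftPseudoInverse_apply_self (H.injective y hy)]

theorem contDiffOn_christoffel (H : IsHypersurfaceOn G U f N) (u v : EuclideanSpace ℝ (Fin n)) :
    ContDiffOn ℝ ∞ (fun y => christoffel G y u v) U :=
  H.contDiffOn_of_fderiv_apply ((H.contDiffOn_hess u v).sub
    ((H.contDiffOn_secondForm u v).smul H.contDiffOn_normal))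
    fun _ hy => H.fderiv_christoffel_eq hy u v

theorem fderiv_fderiv_apply (H : IsHypersurfaceOn G U f N) (hx : x ∈ U)
    {V : EuclideanSpace ℝ (Fin n) → EuclideanSpace ℝ (Fin n)} (hV : DifferentiableAt ℝ V x)
    (u : EuclideanSpace ℝ (Fin n)) :
    fderiv ℝ (fun y => fderiv ℝ f y (V y)) x u
      = hess f x u (V x) + fderiv ℝ f x (fderiv ℝ V x u) := by
  have hd : DifferentiableAt ℝ (fderiv ℝ f) x :=
    (H.contDiffOn_fderiv.contDiffAt (H.mem_nhds hx)).differentiableAt (by simp)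
  rw [hess, fderiv_clm_apply hd hV, fderiv_clm_apply hd (differentiableAt_const _)]
  simp [add_comm]

/-- The Levi-Civita derivative is the tangential part of the derivative in the ambient space. -/
theorem fderiv_covDeriv (H : IsHypersurfaceOn G U f N) (hx : x ∈ U)
    {V : EuclideanSpace ℝ (Fin n) → EuclideanSpace ℝ (Fin n)} (hV : DifferentiableAt ℝ V x)
    (X : EuclideanSpace ℝ (Fin n) → EuclideanSpace ℝ (Fin n)) :
    fderiv ℝ f x (covDeriv G X V x) = fderiv ℝ (fun y => fderiv ℝ f y (V y)) x (X x)
      - secondForm f N x (X x) (V x) • N x := by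
  rw [covDeriv, map_add, H.fderiv_fderiv_apply hx hV, H.fderiv_christoffel_eq hx]
  abel

/-- Weingarten equation. -/
theorem inner_fderiv_normal (H : IsHypersurfaceOn G U f N) (hx : x ∈ U)
    (u v : EuclideanSpace ℝ (Fin n)) :
    inner ℝ (fderiv ℝ N x u) (fderiv ℝ f x v) = -secondForm f N x u v := by
  have h : (fun y => inner ℝ (fderiv ℝ f y v) (N y)) =ᶠ[nhds x] fun _ => (0 : ℝ) :=
    Filter.eventually_of_mem (H.mem_nhds hx) fun y hy => H.inner_normal y hy v
  have h2 := congrArg (fun L : EuclideanSpace ℝ (Fin n) →L[ℝ] ℝ => L u) h.fderiv_eq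
  simp only [fderiv_fun_const, Pi.zero_apply, zero_apply] at h2
  rw [fderiv_inner_apply _ (H.differentiableAt_fderiv_apply hx v)
    (H.differentiableAt_normal hx)] at h2
  rw [secondForm, real_inner_comm]
  exact eq_neg_of_add_eq_zero_left h2

/-- Differentiate the Gauss formula `f_* Γ(v, w) = hess - h(v, w) N`. Multiples of `N` disappear
against `f_* z`, and `-h(v, w) dN(u)` contributes the product of second forms by the Weingarten
equation. -/
theorem inner_fderiv_covDeriv_covDeriv (H : IsHypersurfaceOn G U f N) (hx : x ∈ U)
    (u v w z : EuclideanSpace ℝ (Fin n)) :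
    inner ℝ (fderiv ℝ f x (covDeriv G (fun _ => u) (covDeriv G (fun _ => v) (fun _ => w)) x))
        (fderiv ℝ f x z)
      = inner ℝ (fderiv ℝ (fun y => hess f y v w) x u) (fderiv ℝ f x z)
        + secondForm f N x v w * secondForm f N x u z := by
  have hc : covDeriv G (fun _ => v) (fun _ => w) = fun y => christoffel G y v w := by
    funext y
    simp [covDeriv]
  have hd : DifferentiableAt ℝ (fun y => christoffel G y v w) x :=
    ((H.contDiffOn_christoffel v w).contDiffAt (H.mem_nhds hx)).differentiableAt (by simp)
  have he : (fun y => fderiv ℝ f y (christoffel G y v w)) =ᶠ[nhds x]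
      fun y => hess f y v w - secondForm f N y v w • N y :=
    Filter.eventually_of_mem (H.mem_nhds hx) fun y hy => H.fderiv_christoffel_eq hy v w
  have hs : DifferentiableAt ℝ (fun y => secondForm f N y v w) x :=
    ((H.contDiffOn_secondForm v w).contDiffAt (H.mem_nhds hx)).differentiableAt (by simp)
  rw [hc, H.fderiv_covDeriv hx hd, he.fderiv_eq, fderiv_fun_sub (H.differentiableAt_hess hx v w)
    (hs.fun_smul (H.differentiableAt_normal hx)), fderiv_fun_smul hs (H.differentiableAt_normal hx)]
  have hN : inner ℝ (N x) (fderiv ℝ f x z) = (0 : ℝ) := by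
    rw [real_inner_comm]
    exact H.inner_normal x hx z
  simp only [sub_apply, add_apply,
    smul_apply, ContinuousLinearMap.smulRight_apply, inner_sub_left,
    inner_add_left, real_inner_smul_left, hN, H.inner_fderiv_normal hx]
  ring

/-- Gauss equation. -/
theorem curvature_eq (H : IsHypersurfaceOn G U f N) (hx : x ∈ U)
    (u v w z : EuclideanSpace ℝ (Fin n)) :
    curvature G x u v w z = secondForm f N x v w * secondForm f N x u z
      - secondForm f N x u w * secondForm f N x v z := by
  rw [curvature, curvatureOp, H.metric_eq x hx, map_sub, inner_sub_left,
    H.inner_fderiv_covDeriv_covDeriv hx, H.inner_fderiv_covDeriv_covDeriv hx,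
    H.fderiv_hess_symm hx u v w]
  ring

/-- Metric compatibility of the connection, in the form used when the curvature tensor is
differentiated. -/
theorem fderiv_metric_eq_christoffel (H : IsHypersurfaceOn G U f N) (hx : x ∈ U)
    (s u v : EuclideanSpace ℝ (Fin n)) :
    fderiv ℝ (fun y => G y u v) x s
      = G x (christoffel G x s u) v + G x u (christoffel G x s v) := by
  rw [H.fderiv_metric hx, H.metric_eq x hx, H.metric_eq x hx, H.inner_fderiv_christoffel hx,
    real_inner_comm _ (fderiv ℝ f x u), real_inner_comm _ (fderiv ℝ f x u),
    H.inner_fderiv_christoffel hx]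

end IsHypersurfaceOn
end CoordMetric

/-! ### The profile functions and the orthonormal pair formed by the meridian tangent and the
normal. -/

namespace RotationalHypersurface

variable {n : ℕ} (S : RotationalHypersurface n)

/-- `√(1 + r'²)`, the speed of the profile curve. -/
noncomputable def speed (t : ℝ) : ℝ := √(1 + deriv S.r t ^ 2)

/-- `λ = r' / (r √(1 + r'²))`. -/
noncomputable def lam (t : ℝ) : ℝ := deriv S.r t / (S.r t * S.speed t)

/-- The vector from the centre of the parallel through `X` to `X`. -/
noncomputable def radial (X : EuclideanSpace ℝ (Fin (n + 1))) : EuclideanSpace ℝ (Fin (n + 1)) :=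
  X - S.center (S.height X)

/-- Unit normal of the hypersurface. -/
noncomputable def normal (X : EuclideanSpace ℝ (Fin (n + 1))) : EuclideanSpace ℝ (Fin (n + 1)) :=
  (1 / (S.r (S.height X) * S.speed (S.height X))) • S.radial X
    - (deriv S.r (S.height X) / S.speed (S.height X)) • S.e

/-- Unit tangent vector of the meridians. -/
noncomputable def meridian (X : EuclideanSpace ℝ (Fin (n + 1))) :
    EuclideanSpace ℝ (Fin (n + 1)) :=
  S.lam (S.height X) • S.radial X + (1 / S.speed (S.height X)) • S.e

variable {S} {t : ℝ} {X : EuclideanSpace ℝ (Fin (n + 1))}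

theorem speed_sq : S.speed t ^ 2 = 1 + deriv S.r t ^ 2 := Real.sq_sqrt (by positivity)

theorem speed_pos : 0 < S.speed t := Real.sqrt_pos.2 (by positivity)

theorem contDiffOn_deriv_r : ContDiffOn ℝ ∞ (deriv S.r) S.J :=
  S.contDiffOn_r.deriv_of_isOpen S.isOpen_J (by norm_num)

theorem contDiffOn_deriv_deriv_r : ContDiffOn ℝ ∞ (deriv (deriv S.r)) S.J :=
  contDiffOn_deriv_r.deriv_of_isOpen S.isOpen_J (by norm_num)

theorem contDiffOn_speed : ContDiffOn ℝ ∞ S.speed S.J :=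
  (contDiffOn_const.add (contDiffOn_deriv_r.pow 2)).sqrt fun t _ => by positivity

theorem hasDerivAt_r (ht : t ∈ S.J) : HasDerivAt S.r (deriv S.r t) t :=
  ((S.contDiffOn_r.contDiffAt (S.isOpen_J.mem_nhds ht)).differentiableAt (by simp)).hasDerivAt

theorem hasDerivAt_deriv_r (ht : t ∈ S.J) :
    HasDerivAt (deriv S.r) (deriv (deriv S.r) t) t :=
  ((contDiffOn_deriv_r.contDiffAt (S.isOpen_J.mem_nhds ht)).differentiableAt (by simp)).hasDerivAt

theorem hasDerivAt_speed (ht : t ∈ S.J) :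
    HasDerivAt S.speed (deriv S.r t * deriv (deriv S.r) t / S.speed t) t := by
  have h : HasDerivAt S.speed _ t :=
    ((((hasDerivAt_deriv_r ht).fun_pow 2).const_add 1).sqrt (by positivity))
  refine h.congr_deriv ?_
  simp only [speed]
  field_simp
  ring

theorem a_eq : S.a t = 1 / (S.r t * S.speed t) ^ 2 := by
  rw [a, mul_pow, speed_sq]

theorem b_eq : S.b t = -((S.speed t ^ 2 + S.r t * deriv (deriv S.r) t) /
    (S.r t ^ 2 * S.speed t ^ 4)) := by
  rw [b, ← speed_sq, ← pow_mul]

/-- This is `ξ(a) = 2 λ b` in terms of the height, which grows at rate `1 / speed` along a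
unit-speed meridian. -/
theorem hasDerivAt_a (ht : t ∈ S.J) :
    HasDerivAt S.a (2 * S.lam t * S.b t * S.speed t) t := by
  have hr := S.r_pos t ht
  have hs : 0 < S.speed t := speed_pos
  have h := (((hasDerivAt_r ht).mul (hasDerivAt_speed ht)).pow 2).inv (by
    simp only [Pi.pow_apply, Pi.mul_apply]; positivity)
  have he : S.a = ((S.r * S.speed) ^ 2)⁻¹ := by
    funext t
    simp [a_eq]
  rw [he]
  refine h.congr_deriv ?_
  simp only [lam, b_eq, Pi.pow_apply, Pi.mul_apply]
  field_simp
  ring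

theorem contDiffOn_b : ContDiffOn ℝ ∞ S.b S.J := by
  have h1 : ContDiffOn ℝ ∞ (fun t => 1 + deriv S.r t ^ 2) S.J :=
    contDiffOn_const.add (contDiffOn_deriv_r.pow 2)
  refine ((h1.add (S.contDiffOn_r.mul contDiffOn_deriv_deriv_r)).div
    ((S.contDiffOn_r.pow 2).mul (h1.pow 2)) fun t ht => ?_).neg
  have := S.r_pos t ht
  positivity

theorem hasDerivAt_b (ht : t ∈ S.J) : HasDerivAt S.b (deriv S.b t) t :=
  ((contDiffOn_b.contDiffAt (S.isOpen_J.mem_nhds ht)).differentiableAt (by simp)).hasDerivAt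

theorem height_eq_of_mem_parallel (hX : X ∈ S.parallel t) : S.height X = t := by
  have h := hX.2
  rw [center, ← sub_sub, inner_sub_right, inner_smul_right, real_inner_self_eq_norm_sq,
    S.norm_e] at h
  rw [height]
  linarith

theorem height_mem (hX : X ∈ S.carrier) : S.height X ∈ S.J := by
  obtain ⟨t, ht, hXt⟩ := Set.mem_iUnion₂.1 hX
  rwa [height_eq_of_mem_parallel hXt]

theorem inner_radial_self (hX : X ∈ S.carrier) :
    inner ℝ (S.radial X) (S.radial X) = S.r (S.height X) ^ 2 := by
  obtain ⟨t, ht, hXt⟩ := Set.mem_iUnion₂.1 hX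
  rw [radial, height_eq_of_mem_parallel hXt, real_inner_self_eq_norm_sq]
  exact hXt.1

theorem inner_e_e : inner ℝ S.e S.e = (1 : ℝ) := by
  rw [real_inner_self_eq_norm_sq, S.norm_e, one_pow]

theorem inner_e_radial (X : EuclideanSpace ℝ (Fin (n + 1))) :
    inner ℝ S.e (S.radial X) = (0 : ℝ) := by
  rw [radial, center, ← sub_sub, inner_sub_right, inner_smul_right, inner_e_e, height]
  ring

theorem inner_radial_e (X : EuclideanSpace ℝ (Fin (n + 1))) :
    inner ℝ (S.radial X) S.e = (0 : ℝ) := by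
  rw [real_inner_comm, inner_e_radial]

theorem inner_e_normal (X : EuclideanSpace ℝ (Fin (n + 1))) :
    inner ℝ S.e (S.normal X) = -(deriv S.r (S.height X) / S.speed (S.height X)) := by
  rw [normal, inner_sub_right, inner_smul_right, inner_smul_right, inner_e_e, inner_e_radial]
  ring

theorem inner_e_meridian (X : EuclideanSpace ℝ (Fin (n + 1))) :
    inner ℝ S.e (S.meridian X) = 1 / S.speed (S.height X) := by
  rw [meridian, inner_add_right, inner_smul_right, inner_smul_right, inner_e_e, inner_e_radial]
  ring

theorem inner_normal_self (hX : X ∈ S.carrier) :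
    inner ℝ (S.normal X) (S.normal X) = (1 : ℝ) := by
  have hr := S.r_pos _ (height_mem hX)
  have hs : 0 < S.speed (S.height X) := speed_pos
  have h2 := speed_sq (S := S) (t := S.height X)
  simp only [normal, inner_sub_left, inner_sub_right, real_inner_smul_left, inner_smul_right,
    inner_e_e, inner_e_radial, inner_radial_e, inner_radial_self hX]
  field_simp
  rw [h2]
  ring

theorem inner_meridian_self (hX : X ∈ S.carrier) :
    inner ℝ (S.meridian X) (S.meridian X) = (1 : ℝ) := by
  have hr := S.r_pos _ (height_mem hX)
  have hs : 0 < S.speed (S.height X) := speed_pos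
  have h2 := speed_sq (S := S) (t := S.height X)
  simp only [meridian, lam, inner_add_left, inner_add_right, real_inner_smul_left,
    inner_smul_right, inner_e_e, inner_e_radial, inner_radial_e, inner_radial_self hX]
  field_simp
  rw [h2]
  ring

theorem inner_meridian_normal (hX : X ∈ S.carrier) :
    inner ℝ (S.meridian X) (S.normal X) = (0 : ℝ) := by
  have hr := S.r_pos _ (height_mem hX)
  have hs : 0 < S.speed (S.height X) := speed_pos
  simp only [meridian, normal, lam, inner_add_left, inner_sub_right, real_inner_smul_left,
    inner_smul_right, inner_e_e, inner_e_radial, inner_radial_e, inner_radial_self hX]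
  field_simp
  ring

/-! ### Second fundamental form and curvature of a parametrized rotational hypersurface. -/

/-- `f` is a regular parametrization of a part of `S` by the open set `U`, and `G` is the induced
metric on `U`. -/
structure IsParametrization (S : RotationalHypersurface n)
    (G : EuclideanSpace ℝ (Fin n) → EuclideanSpace ℝ (Fin n) → EuclideanSpace ℝ (Fin n) → ℝ)
    (U : Set (EuclideanSpace ℝ (Fin n)))
    (f : EuclideanSpace ℝ (Fin n) → EuclideanSpace ℝ (Fin (n + 1))) : Prop where
  isOpen : IsOpen U
  contDiffOn : ContDiffOn ℝ ∞ f U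
  metric_eq : ∀ x ∈ U, ∀ u v, G x u v = inner ℝ (fderiv ℝ f x u) (fderiv ℝ f x v)
  injective : ∀ x ∈ U, Function.Injective (fderiv ℝ f x)
  mapsTo : Set.MapsTo f U S.carrier

namespace IsParametrization

open CoordMetric

variable {G : EuclideanSpace ℝ (Fin n) → EuclideanSpace ℝ (Fin n) → EuclideanSpace ℝ (Fin n) → ℝ}
  {U : Set (EuclideanSpace ℝ (Fin n))}
  {f : EuclideanSpace ℝ (Fin n) → EuclideanSpace ℝ (Fin (n + 1))}
  {x : EuclideanSpace ℝ (Fin n)}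

theorem mem_nhds (P : S.IsParametrization G U f) (hx : x ∈ U) : U ∈ nhds x :=
  P.isOpen.mem_nhds hx

theorem hasFDerivAt (P : S.IsParametrization G U f) (hx : x ∈ U) :
    HasFDerivAt f (fderiv ℝ f x) x :=
  ((P.contDiffOn.contDiffAt (P.mem_nhds hx)).differentiableAt (by simp)).hasFDerivAt

theorem height_mem (P : S.IsParametrization G U f) (hx : x ∈ U) : S.height (f x) ∈ S.J :=
  RotationalHypersurface.height_mem (P.mapsTo hx)

theorem contDiffOn_height (P : S.IsParametrization G U f) :
    ContDiffOn ℝ ∞ (fun y => S.height (f y)) U :=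
  contDiffOn_const.inner ℝ (P.contDiffOn.sub contDiffOn_const)

theorem contDiffOn_comp_height (P : S.IsParametrization G U f) {φ : ℝ → ℝ}
    (hφ : ContDiffOn ℝ ∞ φ S.J) : ContDiffOn ℝ ∞ (fun y => φ (S.height (f y))) U :=
  hφ.comp P.contDiffOn_height fun _ hy => P.height_mem hy

theorem contDiffOn_radial (P : S.IsParametrization G U f) :
    ContDiffOn ℝ ∞ (fun y => S.radial (f y)) U :=
  P.contDiffOn.sub (contDiffOn_const.add (P.contDiffOn_height.smul contDiffOn_const))

theorem contDiffOn_normal (P : S.IsParametrization G U f) :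
    ContDiffOn ℝ ∞ (fun y => S.normal (f y)) U := by
  refine ContDiffOn.sub (ContDiffOn.fun_smul ?_ P.contDiffOn_radial)
    (ContDiffOn.fun_smul ?_ contDiffOn_const)
  · refine P.contDiffOn_comp_height (φ := fun t => 1 / (S.r t * S.speed t))
      (contDiffOn_const.div (S.contDiffOn_r.mul contDiffOn_speed) fun t ht => ?_)
    exact (mul_pos (S.r_pos t ht) speed_pos).ne'
  · exact P.contDiffOn_comp_height (φ := fun t => deriv S.r t / S.speed t)
      (contDiffOn_deriv_r.div contDiffOn_speed fun t ht => speed_pos.ne')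

theorem contDiffOn_meridian (P : S.IsParametrization G U f) :
    ContDiffOn ℝ ∞ (fun y => S.meridian (f y)) U := by
  refine ContDiffOn.add (ContDiffOn.fun_smul ?_ P.contDiffOn_radial)
    (ContDiffOn.fun_smul ?_ contDiffOn_const)
  · refine P.contDiffOn_comp_height (φ := S.lam)
      (contDiffOn_deriv_r.div (S.contDiffOn_r.mul contDiffOn_speed) fun t ht => ?_)
    exact (mul_pos (S.r_pos t ht) speed_pos).ne'
  · exact P.contDiffOn_comp_height (φ := fun t => 1 / S.speed t)
      (contDiffOn_const.div contDiffOn_speed fun t ht => speed_pos.ne')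

theorem hasFDerivAt_height (P : S.IsParametrization G U f) (hx : x ∈ U) :
    HasFDerivAt (fun y => S.height (f y)) ((innerSL ℝ S.e).comp (fderiv ℝ f x)) x :=
  (innerSL ℝ S.e).hasFDerivAt.comp x ((P.hasFDerivAt hx).sub_const S.origin)

theorem hasFDerivAt_comp_height (P : S.IsParametrization G U f) (hx : x ∈ U) {φ : ℝ → ℝ} {d : ℝ}
    (hφ : HasDerivAt φ d (S.height (f x))) :
    HasFDerivAt (fun y => φ (S.height (f y))) (d • (innerSL ℝ S.e).comp (fderiv ℝ f x)) x :=
  hφ.comp_hasFDerivAt x (P.hasFDerivAt_height hx)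

theorem hasFDerivAt_radial (P : S.IsParametrization G U f) (hx : x ∈ U) :
    HasFDerivAt (fun y => S.radial (f y))
      (fderiv ℝ f x - ((innerSL ℝ S.e).comp (fderiv ℝ f x)).smulRight S.e) x :=
  (P.hasFDerivAt hx).sub (((P.hasFDerivAt_height hx).smul_const S.e).const_add S.origin)

/-- Differentiate `|radial|² = r(height)²`; the axial part of the derivative of `radial` drops out
because `radial ⊥ e`. -/
theorem inner_radial_fderiv (P : S.IsParametrization G U f) (hx : x ∈ U)
    (v : EuclideanSpace ℝ (Fin n)) :
    inner ℝ (S.radial (f x)) (fderiv ℝ f x v)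
      = S.r (S.height (f x)) * deriv S.r (S.height (f x)) * inner ℝ S.e (fderiv ℝ f x v) := by
  have hρ := P.hasFDerivAt_radial hx
  have h : (fun y => inner ℝ (S.radial (f y)) (S.radial (f y))) =ᶠ[nhds x]
      fun y => (S.r ^ 2) (S.height (f y)) :=
    Filter.eventually_of_mem (P.mem_nhds hx) fun y hy => inner_radial_self (P.mapsTo hy)
  have h1 := (P.hasFDerivAt_comp_height hx ((hasDerivAt_r (P.height_mem hx)).pow 2)).fderiv
  rw [← h.fderiv_eq] at h1
  have h2 := congrArg (fun L : EuclideanSpace ℝ (Fin n) →L[ℝ] ℝ => L v) h1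
  rw [fderiv_inner_apply _ hρ.differentiableAt hρ.differentiableAt, hρ.fderiv] at h2
  simp only [sub_apply, ContinuousLinearMap.smulRight_apply, ContinuousLinearMap.comp_apply,
    innerSL_apply_apply, inner_sub_right, inner_smul_right, inner_radial_e, smul_apply, smul_eq_mul,
    real_inner_comm (S.radial (f x))] at h2
  norm_num at h2
  linarith

theorem isHypersurfaceOn (P : S.IsParametrization G U f) :
    IsHypersurfaceOn G U f (fun y => S.normal (f y)) where
  isOpen := P.isOpen
  contDiffOn := P.contDiffOn
  contDiffOn_normal := P.contDiffOn_normal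
  metric_eq := P.metric_eq
  injective := P.injective
  inner_normal_self _ hx := inner_normal_self (P.mapsTo hx)
  inner_normal x hx u := by
    have hr := S.r_pos _ (P.height_mem hx)
    have hs : 0 < S.speed (S.height (f x)) := speed_pos
    rw [normal, inner_sub_right, inner_smul_right, inner_smul_right,
      real_inner_comm (S.radial (f x)), P.inner_radial_fderiv hx, real_inner_comm S.e]
    field_simp
    ring

/-- The pull-back `u ↦ ⟨T, ∂_u f⟩` of the dual form of the unit tangent `T` of the meridians. -/
noncomputable def covector (S : RotationalHypersurface n)
    (f : EuclideanSpace ℝ (Fin n) → EuclideanSpace ℝ (Fin (n + 1)))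
    (x u : EuclideanSpace ℝ (Fin n)) : ℝ :=
  inner ℝ (S.meridian (f x)) (fderiv ℝ f x u)

/-- Here `η = s dt`: the radial part of the meridian contributes `r'²/s` and the axial part `1/s`,
with sum `s`. From now on `η` can be differentiated through the height. -/
theorem covector_eq (P : S.IsParametrization G U f) (hx : x ∈ U)
    (v : EuclideanSpace ℝ (Fin n)) :
    covector S f x v = S.speed (S.height (f x)) * inner ℝ S.e (fderiv ℝ f x v) := by
  have hr := S.r_pos _ (P.height_mem hx)
  have hs : 0 < S.speed (S.height (f x)) := speed_pos
  have h2 := speed_sq (S := S) (t := S.height (f x))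
  rw [covector, meridian, lam, inner_add_left, real_inner_smul_left, real_inner_smul_left,
    P.inner_radial_fderiv hx]
  field_simp
  rw [h2]
  ring

/-- By Weingarten, `h(u, v) = -⟨dN(u), f_* v⟩`. The derivative of `radial` in `N` yields the
multiple of `g`. Every other term depends on `u` and `v` only through their components along `e`,
hence is a multiple of `η ⊗ η`. -/
theorem secondForm_eq (P : S.IsParametrization G U f) (hx : x ∈ U)
    (u v : EuclideanSpace ℝ (Fin n)) :
    secondForm f (fun y => S.normal (f y)) x u v
      = -(1 / (S.r (S.height (f x)) * S.speed (S.height (f x)))) * G x u v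
        + (S.speed (S.height (f x)) ^ 2 + S.r (S.height (f x)) * deriv (deriv S.r) (S.height (f x)))
          / (S.r (S.height (f x)) * S.speed (S.height (f x)) ^ 3)
          * (covector S f x u * covector S f x v) := by
  have ht := P.height_mem hx
  have hr := S.r_pos _ ht
  have hs : 0 < S.speed (S.height (f x)) := speed_pos
  have h2 := speed_sq (S := S) (t := S.height (f x))
  have hA := P.hasFDerivAt_comp_height hx
    (((hasDerivAt_r ht).mul (hasDerivAt_speed ht)).inv (mul_pos hr hs).ne')
  have hB := P.hasFDerivAt_comp_height hx ((hasDerivAt_deriv_r ht).div (hasDerivAt_speed ht) hs.ne')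
  have hN := (hA.fun_smul (P.hasFDerivAt_radial hx)).fun_sub (hB.smul_const S.e)
  have he : (fun y => S.normal (f y)) = fun y => ((S.r * S.speed)⁻¹) (S.height (f y)) •
      S.radial (f y) - (deriv S.r / S.speed) (S.height (f y)) • S.e := by
    funext y
    simp [normal]
  have hW := P.isHypersurfaceOn.inner_fderiv_normal hx u v
  rw [← neg_eq_iff_eq_neg] at hW
  rw [← hW, he]
  rw [hN.fderiv, P.covector_eq hx, P.covector_eq hx, P.metric_eq x hx]
  simp only [sub_apply, add_apply, smul_apply, ContinuousLinearMap.smulRight_apply,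
    ContinuousLinearMap.comp_apply, innerSL_apply_apply, inner_sub_left, inner_add_left,
    real_inner_smul_left, smul_eq_mul, P.inner_radial_fderiv hx, Pi.mul_apply, Pi.inv_apply]
  generalize inner ℝ S.e (fderiv ℝ f x u) = p
  generalize inner ℝ S.e (fderiv ℝ f x v) = q
  field_simp
  linear_combination (-S.speed (S.height (f x)) ^ 2 * p * q) * h2

theorem differentiableAt_covector (P : S.IsParametrization G U f) (hx : x ∈ U)
    (u : EuclideanSpace ℝ (Fin n)) : DifferentiableAt ℝ (fun y => covector S f y u) x :=
  ((P.contDiffOn_meridian.contDiffAt (P.mem_nhds hx)).differentiableAt (by simp)).inner ℝ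
    (P.isHypersurfaceOn.differentiableAt_fderiv_apply hx u)

/-- The covariant derivative of the meridian form is `λ (g - η ⊗ η)`. -/
theorem fderiv_covector (P : S.IsParametrization G U f) (hx : x ∈ U)
    (s u : EuclideanSpace ℝ (Fin n)) :
    fderiv ℝ (fun y => covector S f y u) x s = covector S f x (christoffel G x s u)
      + S.lam (S.height (f x)) * (G x s u - covector S f x s * covector S f x u) := by
  have ht := P.height_mem hx
  have hr := S.r_pos _ ht
  have hs : 0 < S.speed (S.height (f x)) := speed_pos
  have h2 := speed_sq (S := S) (t := S.height (f x))
  have he : (fun y => covector S f y u) =ᶠ[nhds x]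
      fun y => S.speed (S.height (f y)) * inner ℝ S.e (fderiv ℝ f y u) :=
    Filter.eventually_of_mem (P.mem_nhds hx) fun y hy => P.covector_eq hy u
  have hd := (P.hasFDerivAt_comp_height hx (hasDerivAt_speed ht)).fun_mul
    ((innerSL ℝ S.e).hasFDerivAt.comp x
      (P.isHypersurfaceOn.differentiableAt_fderiv_apply hx u).hasFDerivAt)
  -- The Gauss formula paired with `e`: the covariant Hessian of the height is `⟨e, N⟩ h`.
  have hh : inner ℝ S.e (hess f x s u) = inner ℝ S.e (fderiv ℝ f x (christoffel G x s u))
      + secondForm f (fun y => S.normal (f y)) x s u * inner ℝ S.e (S.normal (f x)) := by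
    rw [P.isHypersurfaceOn.fderiv_christoffel_eq hx, inner_sub_right, inner_smul_right]
    ring
  rw [he.fderiv_eq]
  erw [hd.fderiv]
  simp only [add_apply, smul_apply, ContinuousLinearMap.comp_apply, innerSL_apply_apply,
    smul_eq_mul, Function.comp_apply]
  change _ * inner ℝ S.e (hess f x s u) + _ = _
  rw [hh, P.secondForm_eq hx, inner_e_normal, P.covector_eq hx, P.covector_eq hx, P.covector_eq hx,
    lam]
  generalize inner ℝ S.e (fderiv ℝ f x s) = p
  generalize inner ℝ S.e (fderiv ℝ f x u) = q
  field_simp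
  ring

/-- Substitute `h = A g + B η ⊗ η` in the Gauss equation: `A² = a`, `A B = b`, and the terms in `B²`
cancel. -/
theorem curvature_eq (P : S.IsParametrization G U f) (hx : x ∈ U)
    (u v w z : EuclideanSpace ℝ (Fin n)) :
    curvature G x u v w z = S.a (S.height (f x)) * (G x v w * G x u z - G x u w * G x v z)
      + S.b (S.height (f x)) * (G x v w * (covector S f x u * covector S f x z)
        + G x u z * (covector S f x v * covector S f x w)
        - G x u w * (covector S f x v * covector S f x z)
        - G x v z * (covector S f x u * covector S f x w)) := by
  have hr := S.r_pos _ (P.height_mem hx)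
  have hs : 0 < S.speed (S.height (f x)) := speed_pos
  rw [P.isHypersurfaceOn.curvature_eq hx]
  simp only [P.secondForm_eq hx, a_eq, b_eq]
  field_simp
  ring

theorem metric_comm (P : S.IsParametrization G U f) (hx : x ∈ U)
    (u v : EuclideanSpace ℝ (Fin n)) : G x u v = G x v u := by
  rw [P.metric_eq x hx, P.metric_eq x hx, real_inner_comm]

theorem differentiableAt_metric (P : S.IsParametrization G U f) (hx : x ∈ U)
    (u v : EuclideanSpace ℝ (Fin n)) : DifferentiableAt ℝ (fun y => G y u v) x :=
  ((P.isHypersurfaceOn.differentiableAt_fderiv_apply hx u).inner ℝ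
    (P.isHypersurfaceOn.differentiableAt_fderiv_apply hx v)).congr_of_eventuallyEq
    (Filter.eventually_of_mem (P.mem_nhds hx) fun y hy => P.metric_eq y hy u v)

/-- The Christoffel terms from differentiating `g` and `η` cancel the correction terms in
`nablaCurvature`. What survives comes from `da`, `db` and `∇η = λ (g - η ⊗ η)`. -/
theorem nablaCurvature_eq (P : S.IsParametrization G U f) (hx : x ∈ U)
    {s u v : EuclideanSpace ℝ (Fin n)} (hu : G x u u = 1) (hv : G x v v = 1) (huv : G x u v = 0) :
    nablaCurvature G x s u v v u = 2 * S.lam (S.height (f x)) * S.b (S.height (f x)) *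
        (covector S f x s + covector S f x u * G x s u + covector S f x v * G x s v
          - covector S f x s * (covector S f x u ^ 2 + covector S f x v ^ 2))
      + deriv S.b (S.height (f x)) / S.speed (S.height (f x)) * covector S f x s
        * (covector S f x u ^ 2 + covector S f x v ^ 2) := by
  have ht := P.height_mem hx
  have hs : 0 < S.speed (S.height (f x)) := speed_pos
  have he : (fun y => curvature G y u v v u) =ᶠ[nhds x] fun y =>
      S.a (S.height (f y)) * (G y v v * G y u u - G y u v * G y v u)
      + S.b (S.height (f y)) * (G y v v * (covector S f y u * covector S f y u)
        + G y u u * (covector S f y v * covector S f y v)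
        - G y u v * (covector S f y v * covector S f y u)
        - G y v u * (covector S f y u * covector S f y v)) :=
    Filter.eventually_of_mem (P.mem_nhds hx) fun y hy => P.curvature_eq hy u v v u
  have ha := P.hasFDerivAt_comp_height hx (hasDerivAt_a ht)
  have hb := P.hasFDerivAt_comp_height hx (hasDerivAt_b ht)
  have hg := fun p q => (P.differentiableAt_metric hx p q).hasFDerivAt
  have hc := fun p => (P.differentiableAt_covector hx p).hasFDerivAt
  have hd := (ha.fun_mul (((hg v v).fun_mul (hg u u)).fun_sub ((hg u v).fun_mul (hg v u)))).fun_add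
    (hb.fun_mul (((((hg v v).fun_mul ((hc u).fun_mul (hc u))).fun_add
      ((hg u u).fun_mul ((hc v).fun_mul (hc v)))).fun_sub
      ((hg u v).fun_mul ((hc v).fun_mul (hc u)))).fun_sub
      ((hg v u).fun_mul ((hc u).fun_mul (hc v)))))
  rw [nablaCurvature, he.fderiv_eq, hd.fderiv]
  simp only [add_apply, sub_apply, smul_apply, smul_eq_mul, ContinuousLinearMap.comp_apply,
    innerSL_apply_apply, P.isHypersurfaceOn.fderiv_metric_eq_christoffel hx, P.fderiv_covector hx,
    P.curvature_eq hx]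
  have hτ : inner ℝ S.e (fderiv ℝ f x s) = covector S f x s / S.speed (S.height (f x)) := by
    rw [P.covector_eq hx]
    field_simp
  rw [hτ, P.metric_comm hx v u, P.metric_comm hx v (christoffel G x s u),
    P.metric_comm hx u (christoffel G x s v), P.metric_comm hx u (christoffel G x s u),
    P.metric_comm hx v (christoffel G x s v), hu, hv, huv]
  field_simp
  ring

/-- A constant multiple `V` of the field of meridian directions satisfies `∇_u V = c λ u` for
`u ⊥ V`. -/
theorem covDeriv_smul_meridian (P : S.IsParametrization G U f) (hx : x ∈ U)
    {V W : EuclideanSpace ℝ (Fin n) → EuclideanSpace ℝ (Fin n)} {c : ℝ}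
    (hV : ∀ y ∈ U, fderiv ℝ f y (V y) = S.meridian (f y)) (hW : W =ᶠ[nhds x] fun y => c • V y)
    {u : EuclideanSpace ℝ (Fin n)} (hu : covector S f x u = 0) :
    covDeriv G (fun _ => u) W x = (c * S.lam (S.height (f x))) • u := by
  have ht := P.height_mem hx
  have hr := S.r_pos _ ht
  have hs : 0 < S.speed (S.height (f x)) := speed_pos
  -- Along `u` the height is stationary, so only `radial` varies in `λ radial + e / s`, and its
  -- derivative is `f_* u`. The normal correction vanishes since `h(u, V)` is a multiple of `η(u) =
  -- 0`.
  have hτ : inner ℝ S.e (fderiv ℝ f x u) = (0 : ℝ) := by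
    rw [P.covector_eq hx] at hu
    exact (mul_eq_zero.1 hu).resolve_left hs.ne'
  have hVd : DifferentiableAt ℝ V x :=
    ((P.isHypersurfaceOn.contDiffOn_of_fderiv_apply P.contDiffOn_meridian hV).contDiffAt
      (P.mem_nhds hx)).differentiableAt (by simp)
  have hWd : DifferentiableAt ℝ W x := (hVd.const_smul c).congr_of_eventuallyEq hW
  have hA := P.hasFDerivAt_comp_height hx ((hasDerivAt_deriv_r ht).div
    ((hasDerivAt_r ht).mul (hasDerivAt_speed ht)) (mul_pos hr hs).ne')
  have hB := P.hasFDerivAt_comp_height hx (((hasDerivAt_speed ht)).inv hs.ne')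
  have hT := ((hA.fun_smul (P.hasFDerivAt_radial hx)).fun_add (hB.smul_const S.e)).fun_const_smul c
  have he : (fun y => fderiv ℝ f y (W y)) =ᶠ[nhds x] fun y =>
      c • ((deriv S.r / (S.r * S.speed)) (S.height (f y)) • S.radial (f y)
        + (S.speed⁻¹) (S.height (f y)) • S.e) := by
    filter_upwards [hW, P.mem_nhds hx] with y hy hyU
    rw [hy, map_smul, hV y hyU]
    simp [meridian, lam]
  apply P.injective x hx
  rw [P.isHypersurfaceOn.fderiv_covDeriv hx hWd, he.fderiv_eq, hT.fderiv, P.secondForm_eq hx,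
    hu, P.metric_eq x hx, hW.self_of_nhds, map_smul, hV x hx, inner_smul_right, real_inner_comm]
  rw [covector] at hu
  rw [hu]
  simp [hτ, lam, mul_smul]

end IsParametrization
end RotationalHypersurface

/-! ### Angles with planes, and smoothness of fields read in charts. -/

namespace RiemMetric

variable {n : ℕ} {M : Type*} [TopologicalSpace M] [ChartedSpace (EuclideanSpace ℝ (Fin n)) M]
  [IsManifold (𝓡 n) ∞ M] {g : RiemMetric n M} {p : M}

theorem inner_self_nonneg (g : RiemMetric n M) (p : M) (v : TangentSpace (𝓡 n) p) :
    0 ≤ g.inner p v v := by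
  rcases eq_or_ne v 0 with rfl | hv
  · simp
  · exact (g.pos p v hv).le

theorem eq_zero_of_inner_self {v : TangentSpace (𝓡 n) p} (hv : g.inner p v v = 0) : v = 0 := by
  by_contra h
  exact (g.pos p v h).ne' hv

namespace IsOrthonormalBasis

variable {E : Submodule ℝ (TangentSpace (𝓡 n) p)} {X Y ξ : TangentSpace (𝓡 n) p}

/-- Bessel's inequality: the component of `ξ` orthogonal to the plane has nonnegative square length.
-/
theorem sq_add_sq_le_one (h : IsOrthonormalBasis g p E X Y) (hξ : g.inner p ξ ξ = 1) :
    g.inner p ξ X ^ 2 + g.inner p ξ Y ^ 2 ≤ 1 := by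
  have h0 := g.inner_self_nonneg p (ξ - g.inner p ξ X • X - g.inner p ξ Y • Y)
  simp only [map_sub, map_smul, sub_apply, smul_apply, smul_eq_mul, h.norm_fst, h.norm_snd,
    h.orthogonal, hξ, g.symm p X ξ, g.symm p Y ξ, g.symm p Y X] at h0
  nlinarith

/-- The least angle is realized by the orthogonal projection `A X + B Y` of `ξ`, of length `ρ`, so
its cosine is `ρ`; Bessel's inequality puts `ρ` in the range where `cos (arccos ρ) = ρ`. -/
theorem cos_anglePlane_sq (h : IsOrthonormalBasis g p E X Y) (hξ : g.inner p ξ ξ = 1) :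
    Real.cos (g.anglePlane p ξ E) ^ 2 = g.inner p ξ X ^ 2 + g.inner p ξ Y ^ 2 := by
  set A := g.inner p ξ X with hA
  set B := g.inner p ξ Y with hB
  set ρ := √(A ^ 2 + B ^ 2) with hρ
  have hρ2 : ρ ^ 2 = A ^ 2 + B ^ 2 := Real.sq_sqrt (by positivity)
  have hρ0 : 0 ≤ ρ := Real.sqrt_nonneg _
  have hρ1 : ρ ≤ 1 := Real.sqrt_le_one.2 (h.sq_add_sq_le_one hξ)
  have hself : ∀ x y : ℝ, g.inner p (x • X + y • Y) (x • X + y • Y) = x ^ 2 + y ^ 2 := by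
    intro x y
    simp only [map_add, map_smul, add_apply, smul_apply, smul_eq_mul, h.norm_fst, h.norm_snd,
      h.orthogonal, g.symm p Y X]
    ring
  have hinner : ∀ x y : ℝ, g.inner p ξ (x • X + y • Y) = x * A + y * B := by
    intro x y
    simp [hA, hB]
  have hangle : ∀ Z, g.angle p ξ Z = Real.arccos (g.inner p ξ Z / √(g.inner p Z Z)) := fun Z => by
    rw [angle, hξ, Real.sqrt_one, one_mul]
  have hmem : ∀ x y : ℝ, x • X + y • Y ∈ E := fun x y => by
    rw [← h.span_eq]
    exact Submodule.mem_span_pair.2 ⟨x, y, rfl⟩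
  have hleast : IsLeast {θ | ∃ Z ∈ E, Z ≠ 0 ∧ θ = g.angle p ξ Z} (Real.arccos ρ) := by
    constructor
    · rcases hρ0.eq_or_lt with h0 | h0
      -- If the projection is zero, every nonzero vector of the plane makes a right angle with `ξ`;
      -- `X` serves as witness.
      · have hAB : A = 0 := by nlinarith [sq_nonneg A, sq_nonneg B]
        refine ⟨(1 : ℝ) • X + (0 : ℝ) • Y, hmem 1 0, fun hz => ?_, ?_⟩
        · have := hself 1 0
          rw [hz] at this
          simp at this
        · rw [hangle, hinner, hself, ← h0, hAB]
          simp
      · refine ⟨A • X + B • Y, hmem A B, fun hz => ?_, ?_⟩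
        · have := hself A B
          rw [hz, ← hρ2] at this
          simp only [map_zero] at this
          exact (pow_pos h0 2).ne this
        · rw [hangle, hinner, hself, ← hρ, ← pow_two, ← pow_two, ← hρ2, pow_two,
            mul_div_cancel_right₀ _ h0.ne']
    · rintro θ ⟨Z, hZE, hZ0, rfl⟩
      rw [← h.span_eq] at hZE
      obtain ⟨x, y, rfl⟩ := Submodule.mem_span_pair.1 hZE
      have hpos := g.pos p _ hZ0
      rw [hself] at hpos
      rw [hangle, hinner, hself]
      refine Real.arccos_le_arccos ((div_le_iff₀ (Real.sqrt_pos.2 hpos)).2 ?_)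
      rw [hρ, ← Real.sqrt_mul (by positivity)]
      refine Real.le_sqrt_of_sq_le ?_
      -- Cauchy–Schwarz from Lagrange's identity `(x² + y²)(A² + B²) = (x A + y B)² + (x B - y A)²`.
      nlinarith [sq_nonneg (x * B - y * A)]
  rw [anglePlane, hleast.csInf_eq, Real.cos_arccos (by linarith) hρ1, hρ2]

theorem inner_mul_add (h : IsOrthonormalBasis g p E X Y) {Z : TangentSpace (𝓡 n) p} (hZ : Z ∈ E) :
    g.inner p ξ X * g.inner p Z X + g.inner p ξ Y * g.inner p Z Y = g.inner p ξ Z := by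
  rw [← h.span_eq] at hZ
  obtain ⟨x, y, rfl⟩ := Submodule.mem_span_pair.1 hZ
  simp only [map_add, map_smul, add_apply, smul_apply, smul_eq_mul, h.norm_fst, h.norm_snd,
    h.orthogonal, g.symm p Y X]
  ring

end IsOrthonormalBasis

theorem toChart_surjective {q : M} (hq : q ∈ (extChartAt (𝓡 n) p).source) :
    Function.Surjective (toChart p : TangentSpace (𝓡 n) q → EuclideanSpace ℝ (Fin n)) := by
  obtain ⟨e, he⟩ := isInvertible_mfderiv_extChartAt (I := 𝓡 n) hq
  intro w
  obtain ⟨v, hv⟩ := e.surjective w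
  refine ⟨v, ?_⟩
  rw [toChart, ← he]
  exact hv

theorem toChart_ofChart {x : EuclideanSpace ℝ (Fin n)} (hx : x ∈ (extChartAt (𝓡 n) p).target)
    (u : EuclideanSpace ℝ (Fin n)) : toChart p (ofChart p x u) = u := by
  have h := mfderiv_extChartAt_comp_mfderivWithin_extChartAt_symm (I := 𝓡 n) hx
  rw [ModelWithCorners.range_eq_univ, mfderivWithin_univ] at h
  exact congrArg (fun L : EuclideanSpace ℝ (Fin n) →L[ℝ] EuclideanSpace ℝ (Fin n) => L u) h

/-- A vector field is smooth if its coordinates in the charts are smooth. -/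
theorem contMDiff_of_toChart {ξ : ∀ p : M, TangentSpace (𝓡 n) p}
    (h : ∀ p : M, ContDiffOn ℝ ∞ (fun x => toChart p (ξ ((extChartAt (𝓡 n) p).symm x)))
      (extChartAt (𝓡 n) p).target) :
    ContMDiff (𝓡 n) (𝓡 n).tangent ∞ (fun p : M => (⟨p, ξ p⟩ : TangentBundle (𝓡 n) M)) := by
  intro p
  refine (Bundle.contMDiffAt_section (F := EuclideanSpace ℝ (Fin n)) p).2 ?_
  have hs : ContMDiffAt (𝓡 n) 𝓘(ℝ, EuclideanSpace ℝ (Fin n)) ∞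
      (fun q => toChart p (ξ ((extChartAt (𝓡 n) p).symm (extChartAt (𝓡 n) p q)))) p :=
    ((h p).contDiffAt ((isOpen_extChartAt_target p).mem_nhds
      (mem_extChartAt_target p))).contMDiffAt.comp p contMDiffAt_extChartAt
  refine hs.congr_of_eventuallyEq ?_
  filter_upwards [extChartAt_source_mem_nhds (I := 𝓡 n) p] with q hq
  rw [(extChartAt (𝓡 n) p).left_inv hq]
  have hq' : q ∈ (chartAt (EuclideanSpace ℝ (Fin n)) p).source := by simpa using hq
  -- The trivialization of the tangent bundle at `p` is the differential of the chart at `p`, that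
  -- is, `toChart p`.
  have h1 : (trivializationAt (EuclideanSpace ℝ (Fin n)) (TangentSpace (𝓡 n)) p ⟨q, ξ q⟩).2
      = (trivializationAt (EuclideanSpace ℝ (Fin n)) (TangentSpace (𝓡 n)) p).continuousLinearMapAt
        ℝ q (ξ q) := by
    rw [Bundle.Trivialization.continuousLinearMapAt_apply,
      Bundle.Trivialization.linearMapAt_apply, if_pos (by simpa using hq')]
  exact h1.trans (congrArg (fun L : TangentSpace (𝓡 n) q →L[ℝ] EuclideanSpace ℝ (Fin n) => L (ξ q))
    (TangentBundle.continuousLinearMapAt_trivializationAt (I := 𝓡 n) hq'))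

theorem contMDiff_inner (g : RiemMetric n M) {ξ : ∀ p : M, TangentSpace (𝓡 n) p}
    (hξ : ContMDiff (𝓡 n) (𝓡 n).tangent ∞ (fun p : M => (⟨p, ξ p⟩ : TangentBundle (𝓡 n) M))) :
    ContMDiff (𝓡 n) ((𝓡 n).prod 𝓘(ℝ, EuclideanSpace ℝ (Fin n) →L[ℝ] ℝ)) ∞
      (fun p : M => Bundle.TotalSpace.mk' (EuclideanSpace ℝ (Fin n) →L[ℝ] ℝ)
        (E := fun q : M => TangentSpace (𝓡 n) q →L[ℝ] Bundle.Trivial M ℝ q) p (g.inner p (ξ p))) :=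
  ContMDiff.clm_bundle_apply (F₁ := EuclideanSpace ℝ (Fin n))
    (F₂ := EuclideanSpace ℝ (Fin n) →L[ℝ] ℝ) (E₁ := fun q : M => TangentSpace (𝓡 n) q)
    (E₂ := fun q : M => TangentSpace (𝓡 n) q →L[ℝ] Bundle.Trivial M ℝ q) g.contMDiff hξ

theorem continuous_inner (g : RiemMetric n M) {ξ ζ : ∀ p : M, TangentSpace (𝓡 n) p}
    (hξ : ContMDiff (𝓡 n) (𝓡 n).tangent ∞ (fun p : M => (⟨p, ξ p⟩ : TangentBundle (𝓡 n) M)))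
    (hζ : ContMDiff (𝓡 n) (𝓡 n).tangent ∞ (fun p : M => (⟨p, ζ p⟩ : TangentBundle (𝓡 n) M))) :
    Continuous fun p => g.inner p (ξ p) (ζ p) := by
  have h := ContMDiff.clm_bundle_apply (F₁ := EuclideanSpace ℝ (Fin n)) (F₂ := ℝ)
    (E₁ := fun q : M => TangentSpace (𝓡 n) q) (E₂ := Bundle.Trivial M ℝ) (g.contMDiff_inner hξ) hζ
  refine continuous_iff_continuousAt.2 fun p => ?_
  exact ((Bundle.contMDiffAt_section p).1 (h p)).continuousAt

end RiemMetric

/-! ### Transfer from charts to the manifold, and the choice of sign. -/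

namespace RotationalHypersurface

open RiemMetric

variable {n : ℕ} {S : RotationalHypersurface n} {M : Type*} [TopologicalSpace M]
  [ChartedSpace (EuclideanSpace ℝ (Fin n)) M] [IsManifold (𝓡 n) ∞ M] {g : RiemMetric n M}
  {ι : M → EuclideanSpace ℝ (Fin (n + 1))} {p : M}

namespace IsRealizedBy

theorem mdifferentiableAt (hM : S.IsRealizedBy g ι) (p : M) :
    MDifferentiableAt (𝓡 n) 𝓘(ℝ, EuclideanSpace ℝ (Fin (n + 1))) ι p :=
  (hM.embedding.contMDiff p).mdifferentiableAt (by simp)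

theorem mem_carrier (hM : S.IsRealizedBy g ι) (p : M) : ι p ∈ S.carrier :=
  hM.range_eq ▸ Set.mem_range_self p

theorem fderiv_apply (hM : S.IsRealizedBy g ι) {x : EuclideanSpace ℝ (Fin n)}
    (hx : x ∈ (extChartAt (𝓡 n) p).target) (u : EuclideanSpace ℝ (Fin n)) :
    fderiv ℝ (ι ∘ (extChartAt (𝓡 n) p).symm) x u
      = ambientVector ι ((extChartAt (𝓡 n) p).symm x) (ofChart p x u) := by
  have hs : MDifferentiableAt 𝓘(ℝ, EuclideanSpace ℝ (Fin n)) (𝓡 n) (extChartAt (𝓡 n) p).symm x :=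
    (mdifferentiableOn_extChartAt_symm x hx).mdifferentiableAt
      ((isOpen_extChartAt_target p).mem_nhds hx)
  rw [← mfderiv_eq_fderiv, mfderiv_comp x (hM.mdifferentiableAt _) hs]
  rfl

theorem contDiffOn (hM : S.IsRealizedBy g ι) (p : M) :
    ContDiffOn ℝ ∞ (ι ∘ (extChartAt (𝓡 n) p).symm) (extChartAt (𝓡 n) p).target :=
  contMDiffOn_iff_contDiffOn.1
    (hM.embedding.contMDiff.comp_contMDiffOn (contMDiffOn_extChartAt_symm p))

theorem ambientVector_eq (hM : S.IsRealizedBy g ι) {q : M}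
    (hq : q ∈ (extChartAt (𝓡 n) p).source) (v : TangentSpace (𝓡 n) q) :
    ambientVector ι q v
      = fderiv ℝ (ι ∘ (extChartAt (𝓡 n) p).symm) (extChartAt (𝓡 n) p q) (toChart p v) := by
  have hx := (extChartAt (𝓡 n) p).map_source hq
  have he : ι =ᶠ[nhds q] (ι ∘ (extChartAt (𝓡 n) p).symm) ∘ extChartAt (𝓡 n) p := by
    filter_upwards [(isOpen_extChartAt_source (I := 𝓡 n) p).mem_nhds hq] with y hy
    rw [Function.comp_apply, Function.comp_apply, (extChartAt (𝓡 n) p).left_inv hy]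
  have hf : DifferentiableAt ℝ (ι ∘ (extChartAt (𝓡 n) p).symm) (extChartAt (𝓡 n) p q) :=
    ((hM.contDiffOn p).contDiffAt ((isOpen_extChartAt_target p).mem_nhds hx)).differentiableAt
      (by simp)
  rw [ambientVector, he.mfderiv_eq, mfderiv_comp q hf.mdifferentiableAt
    (mdifferentiableAt_extChartAt (by simpa using hq)), mfderiv_eq_fderiv]
  rfl

theorem isParametrization (hM : S.IsRealizedBy g ι) (p : M) :
    S.IsParametrization (chartMetric g p) (extChartAt (𝓡 n) p).target
      (ι ∘ (extChartAt (𝓡 n) p).symm) where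
  isOpen := isOpen_extChartAt_target p
  contDiffOn := hM.contDiffOn p
  metric_eq x hx u v := by
    rw [chartMetric, hM.metric_eq, hM.fderiv_apply hx, hM.fderiv_apply hx]
  injective x hx := by
    -- Immersivity is read off from the metric: a vector with zero image in `ℝⁿ⁺¹` has zero length,
    -- and `g` is positive definite.
    refine (injective_iff_map_eq_zero _).2 fun u hu => ?_
    rw [hM.fderiv_apply hx] at hu
    have h0 : ofChart p x u = 0 := eq_zero_of_inner_self (g := g) (by
      rw [hM.metric_eq, hu, inner_zero_left])
    rw [← toChart_ofChart hx u, h0, toChart, map_zero]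
    rfl
  mapsTo x _ := hM.mem_carrier _

theorem exists_ambientVector_eq_meridian (hM : S.IsRealizedBy g ι) (p : M) :
    ∃ v : TangentSpace (𝓡 n) p, ambientVector ι p v = S.meridian (ι p) := by
  have hp := mem_extChartAt_source (I := 𝓡 n) p
  obtain ⟨w, hw⟩ := (hM.isParametrization p).isHypersurfaceOn.exists_fderiv_eq
    (mem_extChartAt_target p) (y := S.meridian (ι p)) (by
      simpa using inner_meridian_normal (hM.mem_carrier p))
  obtain ⟨v, rfl⟩ := toChart_surjective hp w
  exact ⟨v, by rw [hM.ambientVector_eq hp, hw]⟩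

variable {ξ ζ : ∀ p : M, TangentSpace (𝓡 n) p}

theorem inner_eq (hM : S.IsRealizedBy g ι) (v w : TangentSpace (𝓡 n) p) :
    g.inner p v w = chartMetric g p (extChartAt (𝓡 n) p p) (toChart p v) (toChart p w) := by
  have hp := mem_extChartAt_source (I := 𝓡 n) p
  rw [(hM.isParametrization p).metric_eq _ (mem_extChartAt_target p), hM.metric_eq,
    hM.ambientVector_eq hp, hM.ambientVector_eq hp]

theorem fderiv_toChart (hM : S.IsRealizedBy g ι)
    (hζ : ∀ p, ambientVector ι p (ζ p) = S.meridian (ι p)) (p : M) :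
    ∀ y ∈ (extChartAt (𝓡 n) p).target, fderiv ℝ (ι ∘ (extChartAt (𝓡 n) p).symm) y
      (toChart p (ζ ((extChartAt (𝓡 n) p).symm y)))
        = S.meridian ((ι ∘ (extChartAt (𝓡 n) p).symm) y) := by
  intro y hy
  have h := hM.ambientVector_eq ((extChartAt (𝓡 n) p).map_target hy)
    (ζ ((extChartAt (𝓡 n) p).symm y))
  rw [(extChartAt (𝓡 n) p).right_inv hy, hζ] at h
  exact h.symm

theorem inner_meridian_eq (hM : S.IsRealizedBy g ι)
    (hζ : ∀ p, ambientVector ι p (ζ p) = S.meridian (ι p)) (v : TangentSpace (𝓡 n) p) :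
    g.inner p (ζ p) v = IsParametrization.covector S (ι ∘ (extChartAt (𝓡 n) p).symm)
      (extChartAt (𝓡 n) p p) (toChart p v) := by
  have hp := mem_extChartAt_source (I := 𝓡 n) p
  rw [hM.metric_eq, hζ, hM.ambientVector_eq hp, IsParametrization.covector, Function.comp_apply,
    (extChartAt (𝓡 n) p).left_inv hp]

theorem inner_meridian_eq_speed_mul (hM : S.IsRealizedBy g ι)
    (hζ : ∀ p, ambientVector ι p (ζ p) = S.meridian (ι p)) (v : TangentSpace (𝓡 n) p) :
    g.inner p (ζ p) v = S.speed (S.height (ι p)) * inner ℝ S.e (ambientVector ι p v) := by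
  have hp := mem_extChartAt_source (I := 𝓡 n) p
  rw [hM.inner_meridian_eq hζ, (hM.isParametrization p).covector_eq (mem_extChartAt_target p),
    ← hM.ambientVector_eq hp, Function.comp_apply, (extChartAt (𝓡 n) p).left_inv hp]

theorem isMeridianField (hM : S.IsRealizedBy g ι)
    (hζ : ∀ p, ambientVector ι p (ζ p) = S.meridian (ι p)) : S.IsMeridianField g ι ζ where
  smooth := contMDiff_of_toChart fun p =>
    (hM.isParametrization p).isHypersurfaceOn.contDiffOn_of_fderiv_apply
      (hM.isParametrization p).contDiffOn_meridian (hM.fderiv_toChart hζ p)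
  unit p := by rw [hM.metric_eq, hζ, inner_meridian_self (hM.mem_carrier p)]
  orthogonal p v hv := by rw [hM.inner_meridian_eq_speed_mul hζ, hv, mul_zero]

/-- Unit fields orthogonal to the parallels are unique up to a locally constant sign. -/
theorem exists_sign (hM : S.IsRealizedBy g ι)
    (hζ : ∀ p, ambientVector ι p (ζ p) = S.meridian (ι p)) (hξ : S.IsMeridianField g ι ξ) :
    ∃ σ : M → ℝ, (∀ p, σ p ^ 2 = 1) ∧ (∀ p, ξ p = σ p • ζ p) ∧
      ∀ p, ∀ᶠ q in nhds p, σ q = σ p := by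
  have hζM := hM.isMeridianField hζ
  -- The difference `ξ - c ζ` is tangent to the parallel, hence orthogonal to both `ξ` and `ζ`,
  -- hence to itself.
  have heq : ∀ p, ξ p = g.inner p (ξ p) (ζ p) • ζ p := by
    intro p
    set c := S.speed (S.height (ι p)) * inner ℝ S.e (ambientVector ι p (ξ p)) with hc
    have hζξ : g.inner p (ζ p) (ξ p) = c := hM.inner_meridian_eq_speed_mul hζ _
    have hw : inner ℝ S.e (ambientVector ι p (ξ p - c • ζ p)) = (0 : ℝ) := by
      have h := hM.inner_meridian_eq_speed_mul hζ (ξ p - c • ζ p)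
      rw [map_sub, map_smul, hζξ, hζM.unit, smul_eq_mul, mul_one, sub_self] at h
      exact (mul_eq_zero.1 h.symm).resolve_left speed_pos.ne'
    have h0 : ξ p - c • ζ p = 0 := eq_zero_of_inner_self (g := g) (by
      conv_lhs => rw [map_sub, map_smul, g.symm p _ (ξ p), g.symm p _ (ζ p)]
      rw [hξ.orthogonal p _ hw, hζM.orthogonal p _ hw, smul_zero, sub_zero])
    rw [g.symm, hζξ]
    exact sub_eq_zero.1 h0
  have hsq : ∀ p, g.inner p (ξ p) (ζ p) ^ 2 = 1 := by
    intro p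
    have h := hξ.unit p
    nth_rw 2 [heq p] at h
    rwa [map_smul, smul_eq_mul, ← pow_two] at h
  refine ⟨fun p => g.inner p (ξ p) (ζ p), hsq, heq, fun p => ?_⟩
  have hcont := (g.continuous_inner hξ.smooth hζM.smooth).continuousAt (x := p)
  -- The sign `g(ξ, ζ)` is continuous with values `±1`, and opposite values lie at distance `2 > 1`.
  -- It need not be globally constant: for `n = 1` the hypersurface consists of two disjoint curves.
  have hnear := hcont.eventually (Metric.ball_mem_nhds _ one_pos)
  filter_upwards [hnear] with q hq
  rw [Real.dist_eq, abs_lt] at hq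
  rcases sq_eq_sq_iff_eq_or_eq_neg.1 ((hsq q).trans (hsq p).symm) with h | h
  · exact h
  · have := hsq p
    nlinarith [hq.1, hq.2]

theorem dirDeriv_comp_height (hM : S.IsRealizedBy g ι) (ξ : ∀ p : M, TangentSpace (𝓡 n) p)
    {φ : ℝ → ℝ} {d : ℝ} (hφ : HasDerivAt φ d (S.height (ι p))) :
    dirDeriv ξ (fun q => φ (S.height (ι q))) p = d * inner ℝ S.e (ambientVector ι p (ξ p)) := by
  have hh : HasFDerivAt (fun X => φ (S.height X)) (d • innerSL ℝ S.e) (ι p) :=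
    hφ.comp_hasFDerivAt (ι p) ((innerSL ℝ S.e).hasFDerivAt.comp (ι p)
      ((hasFDerivAt_id (ι p)).sub_const S.origin))
  have h := hh.hasMFDerivAt.comp p (hM.mdifferentiableAt p).hasMFDerivAt
  have h' := h.mfderiv
  rw [dirDeriv]
  erw [h']
  rfl

/-- For `Z` in the plane, `inner_mul_add` turns `η(X) g(Z,X) + η(Y) g(Z,Y)` into `η(Z)`. This makes
the form collinear with `η` and doubles the term `2 λ b`. -/
theorem sectionalForm_eq (hM : S.IsRealizedBy g ι)
    (hζ : ∀ p, ambientVector ι p (ζ p) = S.meridian (ι p))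
    {E : Submodule ℝ (TangentSpace (𝓡 n) p)} {X Y Z : TangentSpace (𝓡 n) p}
    (h : IsOrthonormalBasis g p E X Y) (hZ : Z ∈ E) :
    g.sectionalForm p X Y Z = (4 * S.lam (S.height (ι p)) * S.b (S.height (ι p)) +
      (deriv S.b (S.height (ι p)) / S.speed (S.height (ι p))
        - 2 * S.b (S.height (ι p)) * S.lam (S.height (ι p))) *
        (g.inner p (ζ p) X ^ 2 + g.inner p (ζ p) Y ^ 2)) * g.inner p (ζ p) Z := by
  have hZ' := h.inner_mul_add (ξ := ζ p) hZ
  rw [sectionalForm, nablaR, (hM.isParametrization p).nablaCurvature_eq (mem_extChartAt_target p)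
    (by rw [← hM.inner_eq, h.norm_fst]) (by rw [← hM.inner_eq, h.norm_snd])
    (by rw [← hM.inner_eq, h.orthogonal]), ← hM.inner_eq, ← hM.inner_eq,
    ← hM.inner_meridian_eq hζ, ← hM.inner_meridian_eq hζ, ← hM.inner_meridian_eq hζ,
    Function.comp_apply, (extChartAt (𝓡 n) p).left_inv (mem_extChartAt_source p)]
  linear_combination 2 * S.lam (S.height (ι p)) * S.b (S.height (ι p)) * hZ'

theorem leviCivitaCoord_eq (hM : S.IsRealizedBy g ι)
    (hζ : ∀ p, ambientVector ι p (ζ p) = S.meridian (ι p)) {σ : M → ℝ}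
    (hσ : ∀ p, ξ p = σ p • ζ p) (hσc : ∀ᶠ q in nhds p, σ q = σ p) {v : TangentSpace (𝓡 n) p}
    (hv : g.inner p (ζ p) v = 0) :
    g.leviCivitaCoord ξ p v = (σ p * S.lam (S.height (ι p))) • toChart p v := by
  have hev : (fun x => toChart p (ξ ((extChartAt (𝓡 n) p).symm x)))
      =ᶠ[nhds (extChartAt (𝓡 n) p p)]
        fun x => σ p • toChart p (ζ ((extChartAt (𝓡 n) p).symm x)) := by
    have hc : Filter.Tendsto (extChartAt (𝓡 n) p).symm (nhds (extChartAt (𝓡 n) p p)) (nhds p) := by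
      have := continuousAt_extChartAt_symm (I := 𝓡 n) p
      rwa [ContinuousAt, (extChartAt (𝓡 n) p).left_inv (mem_extChartAt_source p)] at this
    filter_upwards [hc.eventually hσc] with x hx
    rw [hσ, hx, toChart, map_smul]
    rfl
  have h := (hM.isParametrization p).covDeriv_smul_meridian (mem_extChartAt_target p)
    (hM.fderiv_toChart hζ p) hev (u := toChart p v) (by rw [← hM.inner_meridian_eq hζ, hv])
  rw [leviCivitaCoord, h, Function.comp_apply,
    (extChartAt (𝓡 n) p).left_inv (mem_extChartAt_source p)]

theorem isDirectedBy (hM : S.IsRealizedBy g ι)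
    (hζ : ∀ p, ambientVector ι p (ζ p) = S.meridian (ι p)) (hξ : S.IsMeridianField g ι ξ) :
    g.IsDirectedBy (fun p => g.inner p (ξ p)) := by
  obtain ⟨σ, hσ1, hσ, -⟩ := hM.exists_sign hζ hξ
  have hinner : ∀ p (v : TangentSpace (𝓡 n) p),
      g.inner p (ζ p) v = σ p * g.inner p (ξ p) v := fun p v => by
    rw [hσ p, map_smul, smul_apply, smul_eq_mul, ← mul_assoc, ← pow_two, hσ1, one_mul]
  refine ⟨g.contMDiff_inner hξ.smooth, fun p => ⟨⟨ξ p, hξ.unit p, hξ.unit p⟩, ?_⟩,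
    fun p E _ _ => ?_, fun p E _ hE X Y h Z hZ => ?_⟩
  · rintro _ ⟨v, hv, rfl⟩
    have h0 := g.inner_self_nonneg p (ξ p - v)
    simp only [map_sub, sub_apply, hξ.unit p, g.symm p v (ξ p), hv.out] at h0
    linarith
  -- The factor must be fixed before the orthonormal basis, so `η(X)² + η(Y)²` is expressed by the
  -- angle, which depends on `E` alone.
  · refine ⟨σ p * (4 * S.lam (S.height (ι p)) * S.b (S.height (ι p)) +
      (deriv S.b (S.height (ι p)) / S.speed (S.height (ι p))
        - 2 * S.b (S.height (ι p)) * S.lam (S.height (ι p))) *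
        Real.cos (g.anglePlane p (ζ p) E) ^ 2), fun X Y h Z hZ => ?_⟩
    rw [hM.sectionalForm_eq hζ h hZ, h.cos_anglePlane_sq ((hM.isMeridianField hζ).unit p),
      hinner p Z]
    ring
  · rw [hM.sectionalForm_eq hζ h hZ, hinner p Z, hE Z hZ, mul_zero, mul_zero]

end IsRealizedBy
end RotationalHypersurface

/-! ### The proposition. -/

theorem proposition3p1 {n : ℕ} {M : Type*} [TopologicalSpace M]
    [ChartedSpace (EuclideanSpace ℝ (Fin n)) M] [IsManifold (𝓡 n) ∞ M]
    (S : RotationalHypersurface n) (g : RiemMetric n M)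
    (ι : M → EuclideanSpace ℝ (Fin (n + 1))) (hM : S.IsRealizedBy g ι) :
    g.IsDirected ∧
    (∃ ξ : ∀ p : M, TangentSpace (𝓡 n) p, S.IsMeridianField g ι ξ) ∧
    ∀ ξ : ∀ p : M, TangentSpace (𝓡 n) p, S.IsMeridianField g ι ξ →
      g.IsDirectedBy (fun p => g.inner p (ξ p)) ∧
      ∃ lam : M → ℝ,
        (∀ (p : M) (x : TangentSpace (𝓡 n) p), g.inner p (ξ p) x = 0 →
          g.leviCivitaCoord ξ p x = lam p • RiemMetric.toChart p x) ∧
        (∀ p : M, 2 * lam p * S.b (S.height (ι p)) =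
          dirDeriv ξ (fun q => S.a (S.height (ι q))) p) ∧
        ∀ (p : M) (E : Submodule ℝ (TangentSpace (𝓡 n) p)) (X Y : TangentSpace (𝓡 n) p),
          g.IsOrthonormalBasis p E X Y → ∀ Z ∈ E,
            g.sectionalForm p X Y Z =
              (4 * lam p * S.b (S.height (ι p)) +
                (dirDeriv ξ (fun q => S.b (S.height (ι q))) p
                  - 2 * S.b (S.height (ι p)) * lam p) *
                Real.cos (g.anglePlane p (ξ p) E) ^ 2) * g.inner p (ξ p) Z := by
  -- The tangent vectors are chosen point by point; smoothness of `ζ` follows from that of its image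
  -- `S.meridian` through the smooth left inverse of `fderiv ℝ f`.
  choose ζ hζ using hM.exists_ambientVector_eq_meridian
  have hζM := hM.isMeridianField hζ
  refine ⟨⟨_, hM.isDirectedBy hζ hζM⟩, ⟨ζ, hζM⟩, fun ξ hξ => ⟨hM.isDirectedBy hζ hξ, ?_⟩⟩
  obtain ⟨σ, hσ1, hσ, hσc⟩ := hM.exists_sign hζ hξ
  have hinner : ∀ p (v : TangentSpace (𝓡 n) p),
      g.inner p (ζ p) v = σ p * g.inner p (ξ p) v := fun p v => by
    rw [hσ p, map_smul, smul_apply, smul_eq_mul, ← mul_assoc, ← pow_two, hσ1, one_mul]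
  have hdir : ∀ p {φ : ℝ → ℝ} {d : ℝ}, HasDerivAt φ d (S.height (ι p)) →
      dirDeriv ξ (fun q => φ (S.height (ι q))) p = d * (σ p / S.speed (S.height (ι p))) :=
    fun p φ d hφ => by
      rw [hM.dirDeriv_comp_height ξ hφ, hσ p, RotationalHypersurface.ambientVector, map_smul]
      erw [inner_smul_right]
      have := hζ p
      rw [RotationalHypersurface.ambientVector] at this
      rw [this, RotationalHypersurface.inner_e_meridian, mul_one_div]
  have hheight := fun p => RotationalHypersurface.height_mem (hM.mem_carrier p)
  -- Reversing `ξ` reverses `λ`, hence the factor `σ`.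
  refine ⟨fun p => σ p * S.lam (S.height (ι p)), fun p x hx => ?_, fun p => ?_,
    fun p E X Y h Z hZ => ?_⟩
  · exact hM.leviCivitaCoord_eq hζ hσ (hσc p) (by rw [hinner, hx, mul_zero])
  · rw [hdir p (RotationalHypersurface.hasDerivAt_a (hheight p))]
    have hs : 0 < S.speed (S.height (ι p)) := RotationalHypersurface.speed_pos
    field_simp
  · rw [hM.sectionalForm_eq hζ h hZ, hdir p (RotationalHypersurface.hasDerivAt_b (hheight p)),
      h.cos_anglePlane_sq (hξ.unit p), hinner, hinner, hinner]
    simp only [mul_pow, hσ1, one_mul]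
    ring
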